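/- Let $r\ge 2$ and $1\le \ell\le r$ be integers, let $P_\ell(x_1,\dots,x_r)=\sum_{1\le i_1<\dots<i_\ell\le r}x_{i_1}\cdots x_{i_\ell}$ be the $\ell$-th elementary symmetric polynomial, and for integers $n\ge\binom r\ell$ let $(V_1^{(n)},\dots,V_r^{(n)})$ be a random vector uniformly distributed on the finite nonempty set $$H_{\ell,r}(n)=\{(i_1,\dots,i_r)\in\{1,2,\dots\}^r: P_\ell(i_1,\dots,i_r)\le n\}.$$ Let $\mathcal P$ be the set of primes and let $(\mathcal G_k(p))_{1\le k\le r,\;p\in\mathcal P}$ be mutually independent random variables with $\mathbb P\{\mathcal G_k(p)=j\}=(1-\tfrac1p)p^{-j}$ for $j=0,1,2,\dots$. Let $U_{\ell,r}$ be a random variable independent of the family $(\mathcal G_k(p))_{k,p}$ with the following distribution. If $\ell=r$, then $U_{\ell,r}$ is uniformly distributed on $[0,1]$. If $\ell<r$, then $$\mathbb P\{U_{\ell,r}\le x\}=\frac{\mathrm{Vol}\{y\in[0,\infty)^r: P_\ell(y)\le 1,\ y_1\cdots y_r\le x\}}{\mathrm{Vol}\{y\in[0,\infty)^r: P_\ell(y)\le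 1\}},\qquad 0\le x\le \tbinom r\ell^{-r/\ell},$$ where $\mathrm{Vol}$ is $r$-dimensional Lebesgue measure. Theorem. As $n\to\infty$, the following convergences in distribution hold: $$\frac{\mathrm{LCM}(V_1^{(n)},\dots,V_r^{(n)})}{V_1^{(n)}\cdots V_r^{(n)}}\ \overset{d}{\longrightarrow}\ \prod_{p\in\mathcal P}p^{\max_{1\le k\le r}\mathcal G_k(p)-\sum_{k=1}^r\mathcal G_k(p)},$$ $$\frac{\mathrm{LCM}(V_1^{(n)},\dots,V_r^{(n)})}{n^{r/\ell}}\ \overset{d}{\longrightarrow}\ U_{\ell,r}\prod_{p\in\mathcal P}p^{\max_{1\le k\le r}\mathcal G_k(p)-\sum_{k=1}^r\mathcal G_k(p)}.$$ Moreover, in both relations, for every real $s>0$, the $s$-th moments of the variables on the left and of the limit are finite, and the $s$-th moments of the variables on the left converge to the $s$-th moment of the limit. -/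

import Mathlib

open MeasureTheory ProbabilityTheory Filter Topology

namespace HyperbolicLCM

/-- The `ℓ`-th elementary symmetric polynomial in `r` variables,
`P_ℓ(x_1, …, x_r) = ∑_{i_1 < ⋯ < i_ℓ} x_{i_1} ⋯ x_{i_ℓ}`. -/
def symPoly {R : Type*} [CommSemiring R] (ℓ r : ℕ) (x : Fin r → R) : R :=
  ∑ t ∈ Finset.powersetCard ℓ (Finset.univ : Finset (Fin r)), ∏ i ∈ t, x i

/-- The discrete hyperbolic region: all `r`-tuples of positive integers with `P_ℓ ≤ n`. -/
def discreteRegion (ℓ r n : ℕ) : Set (Fin r → ℕ) :=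
  {i | (∀ k, 1 ≤ i k) ∧ symPoly ℓ r i ≤ n}

/-- The continuous hyperbolic region: all nonnegative real `r`-tuples with `P_ℓ ≤ c`. -/
def continuousRegion (ℓ r : ℕ) (c : ℝ) : Set (Fin r → ℝ) :=
  {y | (∀ k, 0 ≤ y k) ∧ symPoly ℓ r y ≤ c}

/-- For `1 ≤ ℓ < r`: the probability that the product of the coordinates of a point chosen
uniformly from the continuous region `P_ℓ ≤ 1` is at most `x`. -/
noncomputable def productCDF (ℓ r : ℕ) (x : ℝ) : ℝ :=
  volume.real {y : Fin r → ℝ | y ∈ continuousRegion ℓ r 1 ∧ ∏ k, y k ≤ x} /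
    volume.real (continuousRegion ℓ r 1)

/-- `LCM(v_1, …, v_r) / (v_1 ⋯ v_r)`. -/
noncomputable def lcmOverProduct {r : ℕ} (v : Fin r → ℕ) : ℝ :=
  ((Finset.univ.lcm v : ℕ) : ℝ) / ∏ k, (v k : ℝ)

/-- `LCM(v_1, …, v_r) / n ^ (r / ℓ)`. -/
noncomputable def lcmOverPower (ℓ n : ℕ) {r : ℕ} (v : Fin r → ℕ) : ℝ :=
  ((Finset.univ.lcm v : ℕ) : ℝ) / (n : ℝ) ^ ((r : ℝ) / (ℓ : ℝ))

/-- The factor `p ^ (max_k g_k(p) - ∑_k g_k(p))` at the prime `p`; the exponent is an integer. -/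
noncomputable def primeFactorTerm {r : ℕ} (g : Fin r → Nat.Primes → ℕ) (p : Nat.Primes) : ℝ :=
  ((p : ℕ) : ℝ) ^
    (((Finset.univ.sup fun k => g k p : ℕ) : ℤ) - ((∑ k, g k p : ℕ) : ℤ))

/-- The infinite product `∏_p p ^ (max_k g_k(p) - ∑_k g_k(p))` over all primes. -/
noncomputable def primeProduct {r : ℕ} (g : Fin r → Nat.Primes → ℕ) : ℝ :=
  ∏' p : Nat.Primes, primeFactorTerm g p

lemma primeFactorTerm_nonneg {r : ℕ} (g : Fin r → Nat.Primes → ℕ) (p : Nat.Primes) :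
    0 ≤ primeFactorTerm g p := zpow_nonneg (Nat.cast_nonneg _) _

lemma primeFactorTerm_le_one {r : ℕ} (g : Fin r → Nat.Primes → ℕ) (p : Nat.Primes) :
    primeFactorTerm g p ≤ 1 := by
  refine zpow_le_one_of_nonpos₀ (by exact_mod_cast p.2.one_lt.le) ?_
  have h : (Finset.univ.sup fun k => g k p) ≤ ∑ k, g k p :=
    Finset.sup_le fun k hk => Finset.single_le_sum (f := fun k => g k p)
      (fun _ _ => Nat.zero_le _) hk
  have : ((Finset.univ.sup fun k => g k p : ℕ) : ℤ) ≤ ((∑ k, g k p : ℕ) : ℤ) := by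
    exact_mod_cast h
  linarith

/-- The infinite product always converges, so `primeProduct` never takes a default value. -/
lemma multipliable_primeFactorTerm {r : ℕ} (g : Fin r → Nat.Primes → ℕ) :
    Multipliable (primeFactorTerm g) := by
  refine ⟨⨅ s : Finset Nat.Primes, ∏ p ∈ s, primeFactorTerm g p, ?_⟩
  refine tendsto_atTop_ciInf (fun s t hst => ?_) ⟨0, ?_⟩
  · change ∏ p ∈ t, primeFactorTerm g p ≤ ∏ p ∈ s, primeFactorTerm g p
    rw [← Finset.prod_sdiff hst]
    exact mul_le_of_le_one_left (Finset.prod_nonneg fun p _ => primeFactorTerm_nonneg g p)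
      (Finset.prod_le_one (fun p _ => primeFactorTerm_nonneg g p)
        fun p _ => primeFactorTerm_le_one g p)
  · rintro _ ⟨s, rfl⟩
    exact Finset.prod_nonneg fun p _ => primeFactorTerm_nonneg g p

/-- The discrete region is finite, so its `Set.ncard` is its true cardinality. -/
lemma discreteRegion_finite {ℓ r : ℕ} (hℓ : 1 ≤ ℓ) (hℓr : ℓ ≤ r) (n : ℕ) :
    (discreteRegion ℓ r n).Finite := by
  refine (Set.Finite.pi' (t := fun _ : Fin r => Set.Iic n) fun _ => Set.finite_Iic n).subset ?_
  rintro i ⟨hi, hP⟩ k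
  obtain ⟨t, hkt, -, ht⟩ := Finset.exists_subsuperset_card_eq
    (Finset.subset_univ ({k} : Finset (Fin r))) (n := ℓ) (by simpa using hℓ) (by simpa using hℓr)
  have hk : k ∈ t := hkt (Finset.mem_singleton_self k)
  have h1 : i k ≤ ∏ j ∈ t, i j := Finset.single_le_prod' (fun j _ => hi j) hk
  have h2 : ∏ j ∈ t, i j ≤ symPoly ℓ r i :=
    Finset.single_le_sum (f := fun t => ∏ j ∈ t, i j) (fun _ _ => Nat.zero_le _)
      (Finset.mem_powersetCard.2 ⟨Finset.subset_univ t, ht⟩)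
  exact h1.trans (h2.trans hP)

end HyperbolicLCM

/-! The ratio of the least common multiple to the product is a function of the prime exponents of
the coordinates, while the scaled product `X` of the coordinates measures their size. The proof
shows that arithmetic and size become independent: every joint moment of `X` and of the ratio
converges to the product of the separate limit moments.

Only two features of the region matter: it is closed under decreasing coordinates, and the face
where a given coordinate equals 1 is negligible. For an antitone weight with values in `[0, 1]`,
rounding coordinates down to multiples of `d k` compares the full sum with the sum over tuples with
`d k ∣ i k`, up to the factor `∏ d k` and a face error (`prod_mul_sum_dvd_le`,
`sum_le_prod_mul_sum_dvd`). Inclusion-exclusion turns divisibility into exact exponents, whose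
limiting weights are the geometric ones, and dominated convergence treats all exponents at finitely
many primes. A prime affects the ratio only if it divides two coordinates. This has frequency at
most `r ^ 2 / p ^ 2`, so the remaining primes contribute a tail that is small uniformly in `n`
(`IsAdmissible.tendsto_moments`).

The negligible face and the moments of `X` are found in two ways. For `ℓ = r` the region is a
hyperbola: adding a coordinate multiplies the count by an unbounded factor, by divergence of the
harmonic series, and summing along one coordinate gives the uniform moments `1 / (a + 1)`. For `ℓ <
r` the continuous region has finite volume and Riemann sums converge by domination.

All variables lie almost surely in `[0, 1]`, for large `n` at least. Integer moments therefore
determine, by Weierstrass approximation, the limits of all continuous test functions, which gives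
both convergence in distribution and convergence of real moments. -/

namespace HyperbolicLCM

/-! ### Divisibility in down-closed regions -/

/-- A finite set of tuples of positive integers that contains, with a tuple, every smaller tuple of
positive integers. -/
structure IsDownRegion {r : ℕ} (D : Finset (Fin r → ℕ)) : Prop where
  pos : ∀ i ∈ D, ∀ k, 1 ≤ i k
  down : ∀ i ∈ D, ∀ j : Fin r → ℕ, (∀ k, 1 ≤ j k) → j ≤ i → j ∈ D

lemma sum_le_sum_of_injOn {α β : Type*} {s : Finset α} {t : Finset β} (e : α → β)
    {f : α → ℝ} {g : β → ℝ} (hinj : Set.InjOn e s) (hmaps : ∀ x ∈ s, e x ∈ t)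
    (hfg : ∀ x ∈ s, f x ≤ g (e x)) (hg : ∀ y ∈ t, 0 ≤ g y) :
    ∑ x ∈ s, f x ≤ ∑ y ∈ t, g y := by
  classical
  calc ∑ x ∈ s, f x ≤ ∑ x ∈ s, g (e x) := Finset.sum_le_sum hfg
    _ = ∑ y ∈ s.image e, g y := (Finset.sum_image hinj).symm
    _ ≤ ∑ y ∈ t, g y := Finset.sum_le_sum_of_subset_of_nonneg
        (Finset.image_subset_iff.2 hmaps) fun y hy _ => hg y hy

lemma sum_const_box {r : ℕ} (d : Fin r → ℕ) (s : Finset (Fin r → ℕ)) (w : (Fin r → ℕ) → ℝ) :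
    ∑ x ∈ s ×ˢ (Fintype.piFinset fun k => Finset.range (d k)), w x.1 =
      (∏ k, (d k : ℝ)) * ∑ i ∈ s, w i := by
  rw [Finset.sum_product, Finset.mul_sum]
  refine Finset.sum_congr rfl fun i _ => ?_
  simp

open Classical in
/-- Each point with all coordinates divisible carries a full block of smaller points. -/
lemma prod_mul_sum_dvd_le {r : ℕ} {D : Finset (Fin r → ℕ)} (hD : IsDownRegion D)
    (d : Fin r → ℕ) (w : (Fin r → ℕ) → ℝ) (hw0 : ∀ i ∈ D, 0 ≤ w i)
    (hw : ∀ i ∈ D, ∀ j ∈ D, j ≤ i → w i ≤ w j) :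
    (∏ k, (d k : ℝ)) * ∑ i ∈ D with ∀ k, d k ∣ i k, w i ≤ ∑ i ∈ D, w i := by
  rw [← sum_const_box]
  have hlt : ∀ x ∈ {i ∈ D | ∀ k, d k ∣ i k} ×ˢ (Fintype.piFinset fun k => Finset.range (d k)),
      ∀ k, x.2 k < x.1 k := by
    intro x hx k
    simp only [Finset.mem_product, Finset.mem_filter, Fintype.mem_piFinset, Finset.mem_range] at hx
    exact (hx.2 k).trans_le (Nat.le_of_dvd (hD.pos _ hx.1.1 k) (hx.1.2 k))
  have hmem : ∀ x ∈ {i ∈ D | ∀ k, d k ∣ i k} ×ˢ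
      (Fintype.piFinset fun k => Finset.range (d k)), (fun k => x.1 k - x.2 k) ∈ D := by
    intro x hx
    have := hlt x hx
    simp only [Finset.mem_product, Finset.mem_filter] at hx
    exact hD.down x.1 hx.1.1 _ (fun k => by have := this k; omega) fun k => Nat.sub_le _ _
  refine sum_le_sum_of_injOn (fun x k => x.1 k - x.2 k) ?_ hmem ?_ hw0
  · rintro x hx y hy hxy
    have hx' := hlt x hx
    have hy' := hlt y hy
    simp only [Finset.coe_product, Set.mem_prod, Finset.mem_coe, Finset.mem_filter,
      Fintype.mem_piFinset, Finset.mem_range] at hx hy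
    have h2 : ∀ k, x.2 k = y.2 k := by
      intro k
      obtain ⟨a, ha⟩ := hx.1.2 k
      obtain ⟨b, hb⟩ := hy.1.2 k
      have h := congrFun hxy k
      have h1 := hx' k
      have h1' := hy' k
      simp only at h
      -- Both corner points are divisible by `d k` and both offsets are smaller than `d k`, so
      -- reducing modulo `d k` recovers the offset.
      have e : y.2 k + d k * a = x.2 k + d k * b := by omega
      have := congrArg (· % d k) e
      simp only [Nat.add_mul_mod_self_left] at this
      rw [Nat.mod_eq_of_lt (hx.2 k), Nat.mod_eq_of_lt (hy.2 k)] at this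
      exact this.symm
    have h1 : ∀ k, x.1 k = y.1 k := by
      intro k
      have h := congrFun hxy k
      have h1 := hx' k
      have h1' := hy' k
      have := h2 k
      simp only at h
      omega
    exact Prod.ext (funext h1) (funext h2)
  · intro x hx
    refine hw _ (Finset.mem_filter.1 (Finset.mem_product.1 hx).1).1 _ (hmem x hx) ?_
    exact fun k => Nat.sub_le _ _

open Classical in
-- Replacing the `k`-th coordinate by 1 stays in `D`, and the old value, one of `m` possibilities,
-- restores the point.
lemma card_lt_le {r : ℕ} {D : Finset (Fin r → ℕ)} (hD : IsDownRegion D) (k : Fin r) (m : ℕ) :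
    ({i ∈ D | i k < m}.card : ℝ) ≤ m * ({i ∈ D | i k = 1}.card : ℝ) := by
  have h : {i ∈ D | i k < m}.card ≤ ({i ∈ D | i k = 1} ×ˢ Finset.range m).card := by
    refine Finset.card_le_card_of_injOn (fun i => (Function.update i k 1, i k)) ?_ ?_
    · intro i hi
      simp only [Finset.coe_filter, Set.mem_ofPred_eq] at hi
      simp only [Finset.coe_product, Set.mem_prod, Finset.mem_coe, Finset.mem_filter,
        Finset.mem_range, Function.update_self, and_true]
      refine ⟨hD.down i hi.1 _ (fun j => ?_) (fun j => ?_), hi.2⟩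
      · by_cases hj : j = k
        · subst hj; simp
        · simpa [hj] using hD.pos i hi.1 j
      · by_cases hj : j = k
        · subst hj; simpa using hD.pos i hi.1 j
        · simp [hj]
    · intro i _ j _ hij
      simp only [Prod.mk.injEq] at hij
      have := congrArg (fun f => Function.update f k (i k)) hij.1
      simp only [Function.update_idem, Function.update_eq_self] at this
      rw [this, hij.2, Function.update_eq_self]
  rw [Finset.card_product, Finset.card_range] at h
  calc ({i ∈ D | i k < m}.card : ℝ) ≤ (({i ∈ D | i k = 1}.card * m : ℕ) : ℝ) := by exact_mod_cast h
    _ = _ := by push_cast; ring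

open Classical in
-- Rounding each coordinate down to a multiple of `d k` is at most `∏ d k` to one and does not
-- decrease the weight. The result stays positive only if `d k ≤ i k` for all `k`; the other points
-- are paid for by the faces.
lemma sum_le_prod_mul_sum_dvd {r : ℕ} {D : Finset (Fin r → ℕ)} (hD : IsDownRegion D)
    (d : Fin r → ℕ) (hd : ∀ k, 1 ≤ d k) (w : (Fin r → ℕ) → ℝ) (hw0 : ∀ i ∈ D, 0 ≤ w i)
    (hw1 : ∀ i ∈ D, w i ≤ 1) (hw : ∀ i ∈ D, ∀ j ∈ D, j ≤ i → w i ≤ w j) :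
    ∑ i ∈ D, w i ≤ (∏ k, (d k : ℝ)) * ∑ i ∈ D with ∀ k, d k ∣ i k, w i +
      ∑ k, (d k : ℝ) * ({i ∈ D | i k = 1}.card : ℝ) := by
  rw [← Finset.sum_filter_add_sum_filter_not D (fun i => ∀ k, d k ≤ i k)]
  refine add_le_add ?_ ?_
  · rw [← sum_const_box]
    have hmem : ∀ i ∈ {i ∈ D | ∀ k, d k ≤ i k}, (fun k => i k - i k % d k) ∈ D := by
      intro i hi
      rw [Finset.mem_filter] at hi
      refine hD.down i hi.1 _ (fun k => ?_) fun k => Nat.sub_le _ _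
      have := Nat.mod_lt (i k) (hd k)
      have := hi.2 k
      omega
    refine sum_le_sum_of_injOn (fun i => (fun k => i k - i k % d k, fun k => i k % d k)) ?_ ?_ ?_ ?_
    · intro i _ j _ hij
      simp only [Prod.mk.injEq] at hij
      funext k
      have h1 := congrFun hij.1 k
      have h2 := congrFun hij.2 k
      have := Nat.mod_le (i k) (d k)
      have := Nat.mod_le (j k) (d k)
      omega
    · intro i hi
      simp only [Finset.mem_product, Finset.mem_filter, Fintype.mem_piFinset, Finset.mem_range]
      exact ⟨⟨hmem i hi, fun k => Nat.dvd_sub_mod _⟩, fun k => Nat.mod_lt _ (hd k)⟩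
    · intro i hi
      exact hw _ (Finset.mem_filter.1 hi).1 _ (hmem i hi) fun k => Nat.sub_le _ _
    · intro x hx
      exact hw0 _ (Finset.mem_filter.1 (Finset.mem_product.1 hx).1).1
  · calc ∑ i ∈ D with ¬ ∀ k, d k ≤ i k, w i
        ≤ ∑ i ∈ D with ¬ ∀ k, d k ≤ i k, 1 :=
          Finset.sum_le_sum fun i hi => hw1 i (Finset.mem_filter.1 hi).1
      _ = (({i ∈ D | ¬ ∀ k, d k ≤ i k}.card : ℕ) : ℝ) := by simp
      _ ≤ ((∑ k, {i ∈ D | i k < d k}.card : ℕ) : ℝ) := by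
          refine Nat.cast_le.2 (le_trans (Finset.card_le_card ?_) Finset.card_biUnion_le)
          intro i hi
          simp only [not_forall, not_le, Finset.mem_filter] at hi
          obtain ⟨hi, k, hk⟩ := hi
          exact Finset.mem_biUnion.2 ⟨k, Finset.mem_univ k, Finset.mem_filter.2 ⟨hi, hk⟩⟩
      _ ≤ _ := by
          push_cast
          exact Finset.sum_le_sum fun k _ => card_lt_le hD k (d k)

/-! ### Averages and asymptotic independence of divisibility -/

/-- The average of `g` over the finite set `D`. -/
noncomputable def avg {r : ℕ} (D : Finset (Fin r → ℕ)) (g : (Fin r → ℕ) → ℝ) : ℝ :=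
  (∑ i ∈ D, g i) / D.card

lemma avg_nonneg {r : ℕ} {D : Finset (Fin r → ℕ)} {g : (Fin r → ℕ) → ℝ}
    (h : ∀ i ∈ D, 0 ≤ g i) : 0 ≤ avg D g :=
  div_nonneg (Finset.sum_nonneg h) (Nat.cast_nonneg _)

lemma avg_mono {r : ℕ} {D : Finset (Fin r → ℕ)} {f g : (Fin r → ℕ) → ℝ}
    (h : ∀ i ∈ D, f i ≤ g i) : avg D f ≤ avg D g :=
  div_le_div_of_nonneg_right (Finset.sum_le_sum h) (Nat.cast_nonneg _)

lemma avg_congr {r : ℕ} {D : Finset (Fin r → ℕ)} {f g : (Fin r → ℕ) → ℝ}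
    (h : ∀ i ∈ D, f i = g i) : avg D f = avg D g := by
  rw [avg, avg, Finset.sum_congr rfl h]

lemma avg_sub {r : ℕ} (D : Finset (Fin r → ℕ)) (f g : (Fin r → ℕ) → ℝ) :
    avg D (fun i => f i - g i) = avg D f - avg D g := by
  rw [avg, avg, avg, Finset.sum_sub_distrib, sub_div]

lemma avg_const_mul {r : ℕ} (D : Finset (Fin r → ℕ)) (c : ℝ) (g : (Fin r → ℕ) → ℝ) :
    avg D (fun i => c * g i) = c * avg D g := by
  rw [avg, avg, ← Finset.mul_sum, mul_div_assoc]

lemma avg_sum {r : ℕ} {ι : Type*} (D : Finset (Fin r → ℕ)) (s : Finset ι)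
    (g : ι → (Fin r → ℕ) → ℝ) :
    avg D (fun i => ∑ x ∈ s, g x i) = ∑ x ∈ s, avg D (g x) := by
  simp only [avg]
  rw [Finset.sum_comm, Finset.sum_div]

lemma abs_avg_le {r : ℕ} (D : Finset (Fin r → ℕ)) (g : (Fin r → ℕ) → ℝ) :
    |avg D g| ≤ avg D (fun i => |g i|) := by
  rw [avg, avg, abs_div, Nat.abs_cast]
  exact div_le_div_of_nonneg_right (Finset.abs_sum_le_sum_abs _ _) (Nat.cast_nonneg _)

open Classical in
/-- The indicator of the event that `d k` divides the `k`-th coordinate for all `k`. -/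
noncomputable def dvdInd {r : ℕ} (d : Fin r → ℕ) (i : Fin r → ℕ) : ℝ :=
  if ∀ k, d k ∣ i k then 1 else 0

open Classical in
/-- The proportion of the points of `D` whose `k`-th coordinate is `1`. -/
noncomputable def faceRatio {r : ℕ} (D : Finset (Fin r → ℕ)) (k : Fin r) : ℝ :=
  ({i ∈ D | i k = 1}.card : ℝ) / D.card

lemma faceRatio_nonneg {r : ℕ} (D : Finset (Fin r → ℕ)) (k : Fin r) : 0 ≤ faceRatio D k :=
  div_nonneg (Nat.cast_nonneg _) (Nat.cast_nonneg _)

lemma dvdInd_nonneg {r : ℕ} (d i : Fin r → ℕ) : 0 ≤ dvdInd d i := by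
  unfold dvdInd; split_ifs <;> norm_num

open Classical in
lemma sum_mul_dvdInd {r : ℕ} (D : Finset (Fin r → ℕ)) (d : Fin r → ℕ) (w : (Fin r → ℕ) → ℝ) :
    ∑ i ∈ D, w i * dvdInd d i = ∑ i ∈ D with ∀ k, d k ∣ i k, w i := by
  rw [Finset.sum_filter]
  refine Finset.sum_congr rfl fun i _ => ?_
  by_cases h : ∀ k, d k ∣ i k <;> simp [dvdInd, h]

/-- The upper half of the comparison has no error term. The bound is thus uniform over all
down-closed regions, as needed for dominated convergence and for the tail over primes. -/
lemma avg_dvdInd_le {r : ℕ} {D : Finset (Fin r → ℕ)} (hD : IsDownRegion D) (d : Fin r → ℕ)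
    (hd : ∀ k, 1 ≤ d k) : avg D (dvdInd d) ≤ (∏ k, (d k : ℝ))⁻¹ := by
  classical
  rcases D.eq_empty_or_nonempty with rfl | hne
  · simp only [avg, Finset.sum_empty, zero_div]
    positivity
  have hpos : 0 < ∏ k, (d k : ℝ) :=
    Finset.prod_pos fun k _ => by exact_mod_cast hd k
  have hc : (0 : ℝ) < D.card := by exact_mod_cast hne.card_pos
  have h := prod_mul_sum_dvd_le hD d (fun _ => 1) (fun _ _ => zero_le_one)
    (fun _ _ _ _ _ => le_rfl)
  rw [← sum_mul_dvdInd] at h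
  simp only [one_mul, Finset.sum_const, nsmul_eq_mul, mul_one] at h
  rw [avg, div_le_iff₀ hc, ← div_eq_inv_mul, le_div_iff₀ hpos, mul_comm]
  exact h

/-- For an antitone weight, divisibility conditions are asymptotically independent of the weight. -/
lemma abs_avg_mul_dvdInd_sub_le {r : ℕ} {D : Finset (Fin r → ℕ)} (hD : IsDownRegion D)
    (d : Fin r → ℕ) (hd : ∀ k, 1 ≤ d k) (w : (Fin r → ℕ) → ℝ) (hw0 : ∀ i ∈ D, 0 ≤ w i)
    (hw1 : ∀ i ∈ D, w i ≤ 1) (hw : ∀ i ∈ D, ∀ j ∈ D, j ≤ i → w i ≤ w j) :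
    |avg D (fun i => w i * dvdInd d i) - (∏ k, (d k : ℝ))⁻¹ * avg D w| ≤
      (∏ k, (d k : ℝ))⁻¹ * ∑ k, (d k : ℝ) * faceRatio D k := by
  classical
  rcases D.eq_empty_or_nonempty with rfl | hne
  · simp [avg, faceRatio]
  have hpos : 0 < ∏ k, (d k : ℝ) :=
    Finset.prod_pos fun k _ => by exact_mod_cast hd k
  have hc : (0 : ℝ) < D.card := by exact_mod_cast hne.card_pos
  have h1 := prod_mul_sum_dvd_le hD d w hw0 hw
  have h2 := sum_le_prod_mul_sum_dvd hD d hd w hw0 hw1 hw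
  rw [← sum_mul_dvdInd] at h1 h2
  set m := ∏ k, (d k : ℝ)
  have e1 : ∑ i ∈ D, w i * dvdInd d i = avg D (fun i => w i * dvdInd d i) * D.card := by
    rw [avg, div_mul_cancel₀ _ hc.ne']
  have e2 : ∑ i ∈ D, w i = avg D w * D.card := by
    rw [avg, div_mul_cancel₀ _ hc.ne']
  have e3 : ∑ k, (d k : ℝ) * ({i ∈ D | i k = 1}.card : ℝ) =
      (∑ k, (d k : ℝ) * faceRatio D k) * D.card := by
    rw [Finset.sum_mul]
    refine Finset.sum_congr rfl fun k _ => ?_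
    rw [faceRatio, mul_assoc, div_mul_cancel₀ _ hc.ne']
  rw [e1, e2] at h1
  rw [e1, e2, e3] at h2
  rw [← mul_assoc] at h1 h2
  rw [← add_mul] at h2
  have h1' := le_of_mul_le_mul_right h1 hc
  have h2' := le_of_mul_le_mul_right h2 hc
  set A := avg D (fun i => w i * dvdInd d i)
  have eA : A = m⁻¹ * (m * A) := by rw [inv_mul_cancel_left₀ hpos.ne']
  rw [eA, ← mul_sub, abs_mul, abs_of_pos (inv_pos.2 hpos)]
  refine mul_le_mul_of_nonneg_left ?_ (inv_pos.2 hpos).le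
  rw [abs_le]
  constructor <;> linarith [show 0 ≤ ∑ k, (d k : ℝ) * faceRatio D k from
    Finset.sum_nonneg fun k _ => mul_nonneg (Nat.cast_nonneg _) (faceRatio_nonneg D k)]

/-! ### Admissible sequences of regions -/

/-- A sequence of down-closed regions with nonnegligible interior, together with monotone weights
`X n` with values in `[0, 1]`, whose moments converge to `u`. -/
structure IsAdmissible {r : ℕ} (D : ℕ → Finset (Fin r → ℕ)) (X : ℕ → (Fin r → ℕ) → ℝ)
    (u : ℕ → ℝ) : Prop where
  region : ∀ n, IsDownRegion (D n)
  face : ∀ k, Tendsto (fun n => faceRatio (D n) k) atTop (𝓝 0)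
  nonneg : ∀ n, ∀ i ∈ D n, 0 ≤ X n i
  le_one : ∀ n, ∀ i ∈ D n, X n i ≤ 1
  mono : ∀ n, ∀ i ∈ D n, ∀ j ∈ D n, j ≤ i → X n j ≤ X n i
  moment : ∀ a, Tendsto (fun n => avg (D n) (fun i => X n i ^ a)) atTop (𝓝 (u a))

/-- The comparison needs antitone weights but `X n ^ a` is monotone, so it is applied to `1` and to
`1 - X n ^ a` and the results are subtracted. -/
lemma IsAdmissible.tendsto_dvd {r : ℕ} {D : ℕ → Finset (Fin r → ℕ)} {X : ℕ → (Fin r → ℕ) → ℝ}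
    {u : ℕ → ℝ} (h : IsAdmissible D X u) (a : ℕ) (d : Fin r → ℕ) (hd : ∀ k, 1 ≤ d k) :
    Tendsto (fun n => avg (D n) (fun i => X n i ^ a * dvdInd d i)) atTop
      (𝓝 ((∏ k, (d k : ℝ))⁻¹ * u a)) := by
  have key : ∀ w : ℕ → (Fin r → ℕ) → ℝ, (∀ n, ∀ i ∈ D n, 0 ≤ w n i) → (∀ n, ∀ i ∈ D n, w n i ≤ 1) →
      (∀ n, ∀ i ∈ D n, ∀ j ∈ D n, j ≤ i → w n i ≤ w n j) →
      Tendsto (fun n => avg (D n) (fun i => w n i * dvdInd d i) -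
        (∏ k, (d k : ℝ))⁻¹ * avg (D n) (w n)) atTop (𝓝 0) := by
    intro w h0 h1 hm
    refine squeeze_zero_norm (fun n =>
      abs_avg_mul_dvdInd_sub_le (h.region n) d hd (w n) (h0 n) (h1 n) (hm n)) ?_
    have : Tendsto (fun n => (∏ k, (d k : ℝ))⁻¹ * ∑ k, (d k : ℝ) * faceRatio (D n) k) atTop
        (𝓝 ((∏ k, (d k : ℝ))⁻¹ * ∑ k, (d k : ℝ) * 0)) :=
      (tendsto_finsetSum _ fun k _ => (h.face k).const_mul _).const_mul _
    simpa using this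
  have k1 := key (fun _ _ => 1) (fun _ _ _ => zero_le_one) (fun _ _ _ => le_rfl)
    (fun _ _ _ _ _ _ => le_rfl)
  have k2 := key (fun n i => 1 - X n i ^ a)
    (fun n i hi => sub_nonneg.2 (pow_le_one₀ (h.nonneg n i hi) (h.le_one n i hi)))
    (fun n i hi => sub_le_self _ (pow_nonneg (h.nonneg n i hi) a))
    (fun n i hi j hj hij => sub_le_sub_left
      (pow_le_pow_left₀ (h.nonneg n j hj) (h.mono n i hi j hj hij) a) 1)
  have k3 := (k1.sub k2).add ((h.moment a).const_mul (∏ k, (d k : ℝ))⁻¹)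
  simp only [sub_zero, zero_add] at k3
  refine k3.congr fun n => ?_
  have e1 : avg (D n) (fun i => (1 - X n i ^ a) * dvdInd d i) =
      avg (D n) (fun i => 1 * dvdInd d i) - avg (D n) (fun i => X n i ^ a * dvdInd d i) := by
    rw [← avg_sub]; simp only [sub_mul]
  have e2 : avg (D n) (fun i => 1 - X n i ^ a) =
      avg (D n) (fun _ => 1) - avg (D n) (fun i => X n i ^ a) := avg_sub _ _ _
  rw [e1, e2]
  ring

/-! ### Exponents at finitely many primes -/

/-- The exponents of the primes of `S` in the coordinates of `g`. -/
def restrictExp {r : ℕ} (S : Finset Nat.Primes) (g : Fin r → Nat.Primes → ℕ) :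
    Fin r × S → ℕ := fun x => g x.1 x.2

/-- Extension of a family of exponents by zero outside `S`. -/
noncomputable def extendExp {r : ℕ} (S : Finset Nat.Primes) (e : Fin r × S → ℕ) :
    Fin r → Nat.Primes → ℕ :=
  open Classical in fun k p => if h : p ∈ S then e (k, ⟨p, h⟩) else 0

/-- The product of `primeFactorTerm` over a finite set of primes. -/
noncomputable def partialProduct {r : ℕ} (S : Finset Nat.Primes) (g : Fin r → Nat.Primes → ℕ) : ℝ :=
  ∏ p ∈ S, primeFactorTerm g p

/-- The exponents in the prime factorizations of a tuple. -/
noncomputable def valuations {r : ℕ} (i : Fin r → ℕ) : Fin r → Nat.Primes → ℕ :=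
  fun k p => (i k).factorization p

/-- The tuple of integers with prescribed exponents at the primes of `S`. -/
noncomputable def ofExp {r : ℕ} (S : Finset Nat.Primes) (e : Fin r × S → ℕ) (k : Fin r) : ℕ :=
  ∏ p : S, ((p : Nat.Primes) : ℕ) ^ e (k, p)

lemma partialProduct_extendExp {r : ℕ} (S : Finset Nat.Primes) (g : Fin r → Nat.Primes → ℕ) :
    partialProduct S (extendExp S (restrictExp S g)) = partialProduct S g := by
  refine Finset.prod_congr rfl fun p hp => ?_
  simp [primeFactorTerm, extendExp, restrictExp, hp]

lemma partialProduct_nonneg {r : ℕ} (S : Finset Nat.Primes) (g : Fin r → Nat.Primes → ℕ) :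
    0 ≤ partialProduct S g :=
  Finset.prod_nonneg fun p _ => primeFactorTerm_nonneg g p

lemma partialProduct_le_one {r : ℕ} (S : Finset Nat.Primes) (g : Fin r → Nat.Primes → ℕ) :
    partialProduct S g ≤ 1 :=
  Finset.prod_le_one (fun p _ => primeFactorTerm_nonneg g p) fun p _ => primeFactorTerm_le_one g p

lemma one_le_ofExp {r : ℕ} (S : Finset Nat.Primes) (e : Fin r × S → ℕ) (k : Fin r) :
    1 ≤ ofExp S e k :=
  Finset.one_le_prod' fun p _ => Nat.one_le_pow _ _ p.1.2.pos

lemma prod_ofExp {r : ℕ} (S : Finset Nat.Primes) (e : Fin r × S → ℕ) :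
    ∏ k, (ofExp S e k : ℝ) = ∏ x : Fin r × S, ((x.2 : Nat.Primes) : ℝ) ^ e x := by
  rw [Fintype.prod_prod_type]
  refine Finset.prod_congr rfl fun k _ => ?_
  simp [ofExp]

lemma ofExp_dvd_iff {r : ℕ} (S : Finset Nat.Primes) (e : Fin r × S → ℕ) (k : Fin r) (m : ℕ) :
    ofExp S e k ∣ m ↔ ∀ p : S, ((p : Nat.Primes) : ℕ) ^ e (k, p) ∣ m := by
  refine ⟨fun h p => (Finset.dvd_prod_of_mem _ (Finset.mem_univ p)).trans h, fun h => ?_⟩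
  refine Finset.prod_dvd_of_isRelPrime (fun p _ q _ hpq => ?_) fun p _ => h p
  rw [Function.onFun, ← Nat.coprime_iff_isRelPrime]
  refine Nat.Coprime.pow _ _ ((Nat.coprime_primes p.1.2 q.1.2).2 fun h => hpq ?_)
  exact Subtype.ext (Subtype.ext h)

lemma prod_ite_one_zero {ι : Type*} [Fintype ι] (p : ι → Prop) [DecidablePred p]
    [Decidable (∀ x, p x)] :
    ∏ x, (if p x then (1 : ℝ) else 0) = if ∀ x, p x then 1 else 0 := by
  split_ifs with h
  · simp [h]
  · push Not at h
    obtain ⟨x, hx⟩ := h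
    exact Finset.prod_eq_zero (Finset.mem_univ x) (if_neg hx)

open Classical in
lemma prod_dvd_eq_dvdInd {r : ℕ} (S : Finset Nat.Primes) (e : Fin r × S → ℕ) (i : Fin r → ℕ) :
    ∏ x : Fin r × S, (if ((x.2 : Nat.Primes) : ℕ) ^ e x ∣ i x.1 then (1 : ℝ) else 0) =
      dvdInd (ofExp S e) i := by
  rw [prod_ite_one_zero]
  unfold dvdInd
  refine if_congr ?_ rfl rfl
  simp only [ofExp_dvd_iff, Prod.forall]

open Classical in
/-- The indicator of prescribed exact exponents, by inclusion-exclusion. -/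
lemma exactInd_eq_sum {r : ℕ} (S : Finset Nat.Primes) (e : Fin r × S → ℕ) (i : Fin r → ℕ)
    (hi : ∀ k, 1 ≤ i k) :
    (if restrictExp S (valuations i) = e then (1 : ℝ) else 0) =
      ∑ T ∈ (Finset.univ : Finset (Fin r × S)).powerset, (-1) ^ T.card *
        dvdInd (ofExp S fun x => e x + if x ∈ T then 1 else 0) i := by
  have h1 : (if restrictExp S (valuations i) = e then (1 : ℝ) else 0) =
      ∏ x : Fin r × S, ((if ((x.2 : Nat.Primes) : ℕ) ^ e x ∣ i x.1 then (1 : ℝ) else 0) -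
        (if ((x.2 : Nat.Primes) : ℕ) ^ (e x + 1) ∣ i x.1 then (1 : ℝ) else 0)) := by
    have : ∀ x : Fin r × S,
        ((if ((x.2 : Nat.Primes) : ℕ) ^ e x ∣ i x.1 then (1 : ℝ) else 0) -
          (if ((x.2 : Nat.Primes) : ℕ) ^ (e x + 1) ∣ i x.1 then (1 : ℝ) else 0)) =
        if restrictExp S (valuations i) x = e x then 1 else 0 := by
      intro x
      have hx : i x.1 ≠ 0 := by have := hi x.1; omega
      have hv : restrictExp S (valuations i) x = (i x.1).factorization (x.2 : Nat.Primes) := rfl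
      simp only [(x.2 : Nat.Primes).2.pow_dvd_iff_le_factorization hx, ← hv]
      split_ifs <;> first | omega | norm_num
    rw [Finset.prod_congr rfl fun x _ => this x, prod_ite_one_zero]
    refine if_congr ?_ rfl rfl
    simp [funext_iff]
  rw [h1, Finset.prod_sub]
  refine Finset.sum_congr rfl fun T _ => ?_
  rw [mul_assoc, ← prod_dvd_eq_dvdInd, ← Finset.prod_sdiff (Finset.subset_univ T)]
  congr 2
  · refine Finset.prod_congr rfl fun x hx => ?_
    simp [(Finset.mem_sdiff.1 hx).2]
  · refine Finset.prod_congr rfl fun x hx => ?_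
    simp [hx]

/-- The probability that independent geometric variables take the values `e`. -/
noncomputable def geomWeight {r : ℕ} (S : Finset Nat.Primes) (e : Fin r × S → ℕ) : ℝ :=
  ∏ x : Fin r × S, (1 - 1 / (((x.2 : Nat.Primes) : ℕ) : ℝ)) *
    (1 / (((x.2 : Nat.Primes) : ℕ) : ℝ) ^ e x)

/-- Each factor is `p ^ (-e) - p ^ (-(e + 1))`. Expanding the product gives the expansion of
`exactInd_eq_sum` with each divisibility indicator replaced by its limiting frequency, so the two
can be compared term by term. -/
lemma geomWeight_eq_sum {r : ℕ} (S : Finset Nat.Primes) (e : Fin r × S → ℕ) :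
    geomWeight S e = ∑ T ∈ (Finset.univ : Finset (Fin r × S)).powerset, (-1) ^ T.card *
      (∏ k, (ofExp S (fun x => e x + open Classical in if x ∈ T then 1 else 0) k : ℝ))⁻¹ := by
  classical
  have h1 : geomWeight S e = ∏ x : Fin r × S, (((((x.2 : Nat.Primes) : ℕ) : ℝ) ^ e x)⁻¹ -
      ((((x.2 : Nat.Primes) : ℕ) : ℝ) ^ (e x + 1))⁻¹) := by
    refine Finset.prod_congr rfl fun x _ => ?_
    have : (((x.2 : Nat.Primes) : ℕ) : ℝ) ≠ 0 := by exact_mod_cast (x.2 : Nat.Primes).2.ne_zero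
    field_simp
    ring
  rw [h1, Finset.prod_sub]
  refine Finset.sum_congr rfl fun T _ => ?_
  rw [mul_assoc, prod_ofExp, ← Finset.prod_inv_distrib, ← Finset.prod_sdiff (Finset.subset_univ T)]
  congr 2
  · refine Finset.prod_congr rfl fun x hx => ?_
    simp [(Finset.mem_sdiff.1 hx).2]
  · refine Finset.prod_congr rfl fun x hx => ?_
    simp [hx]

open Classical in
lemma IsAdmissible.tendsto_exact {r : ℕ} {D : ℕ → Finset (Fin r → ℕ)} {X : ℕ → (Fin r → ℕ) → ℝ}
    {u : ℕ → ℝ} (h : IsAdmissible D X u) (a : ℕ) (S : Finset Nat.Primes) (e : Fin r × S → ℕ) :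
    Tendsto (fun n => avg (D n) (fun i => X n i ^ a *
      if restrictExp S (valuations i) = e then 1 else 0)) atTop (𝓝 (u a * geomWeight S e)) := by
  have h1 : ∀ n, avg (D n) (fun i => X n i ^ a *
      if restrictExp S (valuations i) = e then 1 else 0) =
      ∑ T ∈ (Finset.univ : Finset (Fin r × S)).powerset, (-1) ^ T.card *
        avg (D n) (fun i => X n i ^ a *
          dvdInd (ofExp S fun x => e x + if x ∈ T then 1 else 0) i) := by
    intro n
    simp only [← avg_const_mul]
    rw [← avg_sum]
    refine avg_congr fun i hi => ?_
    rw [exactInd_eq_sum S e i ((h.region n).pos i hi), Finset.mul_sum]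
    exact Finset.sum_congr rfl fun T _ => by ring
  simp only [h1]
  rw [geomWeight_eq_sum, Finset.mul_sum]
  refine tendsto_finsetSum _ fun T _ => ?_
  have := (h.tendsto_dvd a (ofExp S fun x => e x + if x ∈ T then 1 else 0)
    (one_le_ofExp S _)).const_mul ((-1) ^ T.card)
  convert this using 2
  ring

/-- Each factor `1 - 1 / p` is at least `1 / 2`. This makes the uniform divisibility bound a
summable majorant. -/
lemma prod_inv_le_geomWeight {r : ℕ} (S : Finset Nat.Primes) (e : Fin r × S → ℕ) :
    (∏ k, (ofExp S e k : ℝ))⁻¹ ≤ 2 ^ Fintype.card (Fin r × S) * geomWeight S e := by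
  rw [prod_ofExp, geomWeight, ← Finset.prod_inv_distrib, ← Finset.card_univ, ← Finset.prod_const,
    ← Finset.prod_mul_distrib]
  refine Finset.prod_le_prod (fun x _ => by positivity) fun x _ => ?_
  have h2 : (2 : ℝ) ≤ (((x.2 : Nat.Primes) : ℕ) : ℝ) := by
    exact_mod_cast (x.2 : Nat.Primes).2.two_le
  have h3 : 1 / (((x.2 : Nat.Primes) : ℕ) : ℝ) ≤ 1 / 2 := one_div_le_one_div_of_le (by norm_num) h2
  have h4 : 0 ≤ ((((x.2 : Nat.Primes) : ℕ) : ℝ) ^ e x)⁻¹ := by positivity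
  rw [one_div (_ ^ e x), ← mul_assoc]
  nlinarith

open Classical in
-- The partial product depends only on the exponents at `S`. The average is split according to their
-- values, and the limit passes through the infinite sum by domination.
lemma IsAdmissible.tendsto_partialProduct {r : ℕ} {D : ℕ → Finset (Fin r → ℕ)}
    {X : ℕ → (Fin r → ℕ) → ℝ} {u : ℕ → ℝ} (h : IsAdmissible D X u) (a b : ℕ)
    (S : Finset Nat.Primes) (hS : Summable (geomWeight (r := r) S)) :
    Tendsto (fun n => avg (D n) (fun i => X n i ^ a * partialProduct S (valuations i) ^ b)) atTop
      (𝓝 (u a * ∑' e : Fin r × S → ℕ, geomWeight S e * partialProduct S (extendExp S e) ^ b)) := by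
  have h1 : ∀ n, avg (D n) (fun i => X n i ^ a * partialProduct S (valuations i) ^ b) =
      ∑' e : Fin r × S → ℕ, partialProduct S (extendExp S e) ^ b *
        avg (D n) (fun i => X n i ^ a * if restrictExp S (valuations i) = e then 1 else 0) := by
    intro n
    simp only [← avg_const_mul]
    have hz : ∀ i, ∀ e ≠ restrictExp S (valuations i), partialProduct S (extendExp S e) ^ b *
        (X n i ^ a * if restrictExp S (valuations i) = e then 1 else 0) = 0 := by
      intro i e he
      rw [if_neg he.symm, mul_zero, mul_zero]
    simp only [avg]
    rw [tsum_div_const, Summable.tsum_finsetSum]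
    · congr 1
      refine Finset.sum_congr rfl fun i _ => ?_
      rw [tsum_eq_single (restrictExp S (valuations i)) (hz i), partialProduct_extendExp]
      simp [mul_comm]
    · intro i _
      exact summable_of_ne_finset_zero (s := {restrictExp S (valuations i)}) fun e he =>
        hz i e (by simpa using he)
  simp only [h1]
  rw [← tsum_mul_left]
  refine tendsto_tsum_of_dominated_convergence
    (bound := fun e => 2 ^ Fintype.card (Fin r × S) * geomWeight S e) (hS.mul_left _) ?_ ?_
  · intro e
    have := (h.tendsto_exact a S e).const_mul (partialProduct S (extendExp S e) ^ b)
    convert this using 2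
    ring
  · refine Eventually.of_forall fun n e => ?_
    have h0 : 0 ≤ avg (D n) (fun i => X n i ^ a *
        if restrictExp S (valuations i) = e then 1 else 0) :=
      avg_nonneg fun i hi => mul_nonneg (pow_nonneg (h.nonneg n i hi) a) (by split_ifs <;> norm_num)
    rw [Real.norm_eq_abs, abs_of_nonneg
      (mul_nonneg (pow_nonneg (partialProduct_nonneg _ _) b) h0)]
    refine (mul_le_of_le_one_left h0
      (pow_le_one₀ (partialProduct_nonneg _ _) (partialProduct_le_one _ _))).trans ?_
    -- Exponents exactly `e` force divisibility by `ofExp S e`, whose frequency is bounded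
    -- independently of `n`.
    refine le_trans ?_ (prod_inv_le_geomWeight S e)
    refine le_trans (avg_mono fun i hi => ?_) (avg_dvdInd_le (h.region n) _ (one_le_ofExp S e))
    refine (mul_le_of_le_one_left (by split_ifs <;> norm_num)
      (pow_le_one₀ (h.nonneg n i hi) (h.le_one n i hi))).trans ?_
    split_ifs with heq
    · have : ∀ k, ofExp S e k ∣ i k := by
        intro k
        rw [ofExp_dvd_iff]
        intro p
        have hk : i k ≠ 0 := by have := (h.region n).pos i hi k; omega
        rw [(p : Nat.Primes).2.pow_dvd_iff_le_factorization hk, ← heq]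
        rfl
      rw [dvdInd, if_pos this]
    · exact dvdInd_nonneg _ _

/-! ### From finitely many primes to the least common multiple -/

lemma cast_eq_prod_pow_factorization {m : ℕ} (hm : m ≠ 0) (S : Finset Nat.Primes)
    (hS : ∀ p : Nat.Primes, (p : ℕ) ∣ m → p ∈ S) :
    (m : ℝ) = ∏ p ∈ S, (((p : Nat.Primes) : ℕ) : ℝ) ^ m.factorization p := by
  have h : m.factorization.prod (fun p e => p ^ e) =
      ∏ p ∈ S.map ⟨fun p : Nat.Primes => (p : ℕ), Subtype.val_injective⟩,
        p ^ m.factorization p := by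
    refine Finsupp.prod_of_support_subset _ (fun p hp => ?_) _ fun p _ => pow_zero p
    rw [Nat.support_factorization, Nat.mem_primeFactors] at hp
    exact Finset.mem_map.2 ⟨⟨p, hp.1⟩, hS ⟨p, hp.1⟩ hp.2.1, rfl⟩
  rw [Nat.prod_factorization_pow_eq_self hm, Finset.prod_map] at h
  exact_mod_cast h

/-- At a prime dividing at most one coordinate the maximum of the exponents equals their sum, so its
factor is 1. -/
lemma lcmOverProduct_eq_partialProduct {r : ℕ} (v : Fin r → ℕ) (hv : ∀ k, 1 ≤ v k)
    (S : Finset Nat.Primes)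
    (hS : ∀ p : Nat.Primes, p ∉ S → ∀ k l, (p : ℕ) ∣ v k → (p : ℕ) ∣ v l → k = l) :
    lcmOverProduct v = partialProduct S (valuations v) := by
  classical
  have hv0 : ∀ k, v k ≠ 0 := fun k => Nat.one_le_iff_ne_zero.1 (hv k)
  have hN : ∏ k, v k ≠ 0 := Finset.prod_ne_zero_iff.2 fun k _ => hv0 k
  have hL : Finset.univ.lcm v ≠ 0 := by
    rw [Ne, Finset.lcm_eq_zero_iff]
    simpa using hv0
  have hdvd : Finset.univ.lcm v ∣ ∏ k, v k :=
    Finset.lcm_dvd fun k _ => Finset.dvd_prod_of_mem _ (Finset.mem_univ k)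
  set S' : Finset Nat.Primes := S ∪ (∏ k, v k).primeFactors.subtype Nat.Prime with hS'
  have hmem : ∀ p : Nat.Primes, (p : ℕ) ∣ ∏ k, v k → p ∈ S' := fun p hp =>
    Finset.mem_union_right _ (Finset.mem_subtype.2 (Nat.mem_primeFactors.2 ⟨p.2, hp, hN⟩))
  have e1 := cast_eq_prod_pow_factorization hL S' fun p hp => hmem p (hp.trans hdvd)
  have e2 := cast_eq_prod_pow_factorization hN S' hmem
  have hfac : ∀ p : ℕ, (∏ k, v k).factorization p = ∑ k, (v k).factorization p := by
    intro p
    rw [Nat.factorization_prod fun k _ => hv0 k, Finsupp.finsetSum_apply]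
  have key : lcmOverProduct v = ∏ p ∈ S', primeFactorTerm (valuations v) p := by
    rw [lcmOverProduct, ← Nat.cast_prod, e1, e2, ← Finset.prod_div_distrib]
    refine Finset.prod_congr rfl fun p _ => ?_
    have hp : (((p : Nat.Primes) : ℕ) : ℝ) ≠ 0 := by exact_mod_cast p.2.ne_zero
    rw [primeFactorTerm, zpow_sub₀ hp, zpow_natCast, zpow_natCast, hfac,
      Finset.factorization_lcm fun k _ => hv0 k]
    rfl
  rw [key]
  refine (Finset.prod_subset Finset.subset_union_left fun p _ hp => ?_).symm
  have hsup : (Finset.univ.sup fun k => valuations v k p) = ∑ k, valuations v k p := by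
    by_cases h : ∃ k, valuations v k p ≠ 0
    · obtain ⟨k, hk⟩ := h
      have hl : ∀ l, l ≠ k → valuations v l p = 0 := by
        intro l hl
        by_contra h0
        exact hl (hS p hp l k (Nat.dvd_of_factorization_pos h0) (Nat.dvd_of_factorization_pos hk))
      rw [Finset.sum_eq_single k (fun l _ => hl l) (by simp)]
      refine le_antisymm (Finset.sup_le fun l _ => ?_)
        (Finset.le_sup (f := fun k => valuations v k p) (Finset.mem_univ k))
      by_cases hlk : l = k
      · rw [hlk]
      · rw [hl l hlk]; exact Nat.zero_le _
    · push Not at h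
      simp [h]
  rw [primeFactorTerm, hsup, sub_self, zpow_zero]

lemma lcmOverProduct_nonneg {r : ℕ} (v : Fin r → ℕ) : 0 ≤ lcmOverProduct v := by
  unfold lcmOverProduct; positivity

lemma lcmOverProduct_le_one {r : ℕ} (v : Fin r → ℕ) : lcmOverProduct v ≤ 1 := by
  refine div_le_one_of_le₀ ?_ (by positivity)
  rw [← Nat.cast_prod]
  -- A zero coordinate makes the least common multiple zero as well, so the bound survives the
  -- default value `0 / 0 = 0`.
  by_cases hN : ∏ k, v k = 0
  · obtain ⟨k, -, hk⟩ := Finset.prod_eq_zero_iff.1 hN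
    rw [hN, (Finset.lcm_eq_zero_iff (s := Finset.univ) (f := v)).2 ⟨k, by simp [hk]⟩]
  · exact Nat.cast_le.2 (Nat.le_of_dvd (Nat.pos_of_ne_zero hN)
      (Finset.lcm_dvd fun k _ => Finset.dvd_prod_of_mem _ (Finset.mem_univ k)))

lemma summable_inv_primes_sq : Summable fun p : Nat.Primes => ((((p : ℕ) : ℝ)) ^ 2)⁻¹ :=
  (Real.summable_nat_pow_inv.2 one_lt_two).comp_injective Subtype.val_injective

lemma avg_pair_dvd_le {r : ℕ} {D : Finset (Fin r → ℕ)} (hD : IsDownRegion D) (p : Nat.Primes)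
    {k l : Fin r} (hkl : k ≠ l) :
    avg D (dvdInd fun j => if j = k ∨ j = l then (p : ℕ) else 1) ≤ (((p : ℕ) : ℝ) ^ 2)⁻¹ := by
  refine (avg_dvdInd_le hD _ fun j => ?_).trans_eq ?_
  · split_ifs
    exacts [p.2.one_lt.le, le_rfl]
  · congr 1
    have h : ∀ j : Fin r, ((if j = k ∨ j = l then (p : ℕ) else 1 : ℕ) : ℝ) =
        if j ∈ ({k, l} : Finset (Fin r)) then ((p : ℕ) : ℝ) else 1 := by
      intro j
      simp only [Finset.mem_insert, Finset.mem_singleton]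
      split_ifs <;> simp
    simp only [h]
    rw [Finset.prod_ite_mem, Finset.univ_inter, Finset.prod_pair hkl, sq]

/-- Primes outside `S` rarely divide two coordinates. -/
lemma avg_abs_lcmOverProduct_sub_le {r : ℕ} {D : Finset (Fin r → ℕ)} (hD : IsDownRegion D)
    (S : Finset Nat.Primes) (b : ℕ) :
    avg D (fun i => |lcmOverProduct i ^ b - partialProduct S (valuations i) ^ b|) ≤
      (r : ℝ) ^ 2 * ∑' p : {p : Nat.Primes // p ∉ S}, ((((p : Nat.Primes) : ℕ) : ℝ) ^ 2)⁻¹ := by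
  classical
  -- Only primes dividing some coordinate of some point of `D` can occur, which makes the union
  -- bound a finite sum.
  set F : Finset Nat.Primes := (∏ i ∈ D, ∏ k, i k).primeFactors.subtype Nat.Prime with hF
  have hF' : ∀ i ∈ D, ∀ k, ∀ p : Nat.Primes, (p : ℕ) ∣ i k → p ∈ F := by
    intro i hi k p hp
    refine Finset.mem_subtype.2 (Nat.mem_primeFactors.2 ⟨p.2, ?_, ?_⟩)
    · exact (hp.trans (Finset.dvd_prod_of_mem _ (Finset.mem_univ k))).trans
        (Finset.dvd_prod_of_mem (fun i : Fin r → ℕ => ∏ k, i k) hi)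
    · exact Finset.prod_ne_zero_iff.2 fun i hi => Finset.prod_ne_zero_iff.2 fun k _ =>
        Nat.one_le_iff_ne_zero.1 (hD.pos i hi k)
  -- The two powers agree unless a prime outside `S` divides two coordinates. In that case they
  -- differ by at most 1, and one summand on the right equals 1.
  have hpt : ∀ i ∈ D, |lcmOverProduct i ^ b - partialProduct S (valuations i) ^ b| ≤
      ∑ p ∈ F \ S, ∑ x ∈ {x : Fin r × Fin r | x.1 ≠ x.2},
        dvdInd (fun j => if j = x.1 ∨ j = x.2 then (p : ℕ) else 1) i := by
    intro i hi
    have hn : ∀ p ∈ F \ S, 0 ≤ ∑ x ∈ {x : Fin r × Fin r | x.1 ≠ x.2},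
        dvdInd (fun j => if j = x.1 ∨ j = x.2 then (p : ℕ) else 1) i :=
      fun p _ => Finset.sum_nonneg fun x _ => dvdInd_nonneg _ _
    by_cases h : ∀ p : Nat.Primes, p ∉ S → ∀ k l, (p : ℕ) ∣ i k → (p : ℕ) ∣ i l → k = l
    · rw [lcmOverProduct_eq_partialProduct i (hD.pos i hi) S h, sub_self, abs_zero]
      exact Finset.sum_nonneg hn
    · push Not at h
      obtain ⟨p, hpS, k, l, hk, hl, hkl⟩ := h
      have h1 : |lcmOverProduct i ^ b - partialProduct S (valuations i) ^ b| ≤ 1 := by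
        have a1 := pow_nonneg (lcmOverProduct_nonneg i) b
        have a2 := pow_le_one₀ (n := b) (lcmOverProduct_nonneg i) (lcmOverProduct_le_one i)
        have a3 := pow_nonneg (partialProduct_nonneg S (valuations i)) b
        have a4 := pow_le_one₀ (n := b) (partialProduct_nonneg S (valuations i))
          (partialProduct_le_one S (valuations i))
        rw [abs_le]
        constructor <;> linarith
      have h2 : dvdInd (fun j => if j = k ∨ j = l then (p : ℕ) else 1) i = 1 := by
        rw [dvdInd, if_pos]
        intro j
        split_ifs with hj
        · rcases hj with rfl | rfl <;> assumption
        · exact one_dvd _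
      refine h1.trans (h2.symm.le.trans ?_)
      refine le_trans ?_ (Finset.single_le_sum hn
        (Finset.mem_sdiff.2 ⟨hF' i hi k p hk, hpS⟩))
      exact Finset.single_le_sum
        (f := fun x : Fin r × Fin r => dvdInd (fun j => if j = x.1 ∨ j = x.2 then (p : ℕ) else 1) i)
        (fun x _ => dvdInd_nonneg _ _) (a := (k, l)) (by simpa using hkl)
  refine (avg_mono hpt).trans ?_
  rw [avg_sum]
  have h3 : ∀ p ∈ F \ S, avg D (fun i => ∑ x ∈ {x : Fin r × Fin r | x.1 ≠ x.2},
      dvdInd (fun j => if j = x.1 ∨ j = x.2 then (p : ℕ) else 1) i) ≤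
        (r : ℝ) ^ 2 * (((p : ℕ) : ℝ) ^ 2)⁻¹ := by
    intro p _
    rw [avg_sum]
    refine (Finset.sum_le_card_nsmul _ _ _ fun x hx =>
      avg_pair_dvd_le hD p (by simpa using hx)).trans ?_
    rw [nsmul_eq_mul]
    refine mul_le_mul_of_nonneg_right ?_ (by positivity)
    have : ({x : Fin r × Fin r | x.1 ≠ x.2} : Finset _).card ≤ r ^ 2 :=
      (Finset.card_le_univ _).trans_eq (by simp [sq])
    exact_mod_cast this
  refine (Finset.sum_le_sum h3).trans ?_
  rw [← Finset.mul_sum]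
  refine mul_le_mul_of_nonneg_left ?_ (by positivity)
  have h4 : ∑ p ∈ F \ S, (((p : ℕ) : ℝ) ^ 2)⁻¹ =
      ∑ p ∈ (F \ S).subtype (· ∉ S), ((((p : Nat.Primes) : ℕ) : ℝ) ^ 2)⁻¹ := by
    rw [Finset.sum_subtype_eq_sum_filter (f := fun p : Nat.Primes => (((p : ℕ) : ℝ) ^ 2)⁻¹),
      Finset.filter_true_of_mem]
    exact fun p hp => (Finset.mem_sdiff.1 hp).2
  rw [h4]
  exact (summable_inv_primes_sq.subtype _).sum_le_tsum _ fun p _ => by positivity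

/-- The limits in `n` and in `S` may be interchanged because the error from primes outside `S` is
small uniformly in `n`. -/
lemma IsAdmissible.tendsto_lcm {r : ℕ} {D : ℕ → Finset (Fin r → ℕ)} {X : ℕ → (Fin r → ℕ) → ℝ}
    {u : ℕ → ℝ} (h : IsAdmissible D X u) (a b : ℕ) (c : Finset Nat.Primes → ℝ) (c' : ℝ)
    (hc : ∀ S, Tendsto (fun n => avg (D n) (fun i => X n i ^ a *
      partialProduct S (valuations i) ^ b)) atTop (𝓝 (u a * c S)))
    (hc' : Tendsto c atTop (𝓝 c')) :
    Tendsto (fun n => avg (D n) (fun i => X n i ^ a * lcmOverProduct i ^ b)) atTop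
      (𝓝 (u a * c')) := by
  have htail : Tendsto (fun S : Finset Nat.Primes => (r : ℝ) ^ 2 *
      ∑' p : {p : Nat.Primes // p ∉ S}, ((((p : Nat.Primes) : ℕ) : ℝ) ^ 2)⁻¹) atTop (𝓝 0) := by
    simpa using (tendsto_tsum_compl_atTop_zero
      (fun p : Nat.Primes => (((p : ℕ) : ℝ) ^ 2)⁻¹)).const_mul ((r : ℝ) ^ 2)
  rw [Metric.tendsto_nhds]
  intro ε hε
  obtain ⟨S, hS1, hS2⟩ := ((htail.eventually_lt_const (by positivity : 0 < ε / 3)).and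
    (Metric.tendsto_nhds.1 (hc'.const_mul (u a)) (ε / 3) (by positivity))).exists
  filter_upwards [Metric.tendsto_nhds.1 (hc S) (ε / 3) (by positivity)] with n hn
  have h1 : dist (avg (D n) (fun i => X n i ^ a * lcmOverProduct i ^ b))
      (avg (D n) (fun i => X n i ^ a * partialProduct S (valuations i) ^ b)) < ε / 3 := by
    rw [Real.dist_eq, ← avg_sub]
    refine (abs_avg_le _ _).trans_lt (lt_of_le_of_lt (le_trans (avg_mono fun i hi => ?_)
      (avg_abs_lcmOverProduct_sub_le (h.region n) S b)) hS1)
    rw [← mul_sub, abs_mul, abs_of_nonneg (pow_nonneg (h.nonneg n i hi) a)]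
    exact mul_le_of_le_one_left (abs_nonneg _) (pow_le_one₀ (h.nonneg n i hi) (h.le_one n i hi))
  have t1 := dist_triangle (avg (D n) (fun i => X n i ^ a * lcmOverProduct i ^ b))
    (avg (D n) (fun i => X n i ^ a * partialProduct S (valuations i) ^ b)) (u a * c')
  have t2 := dist_triangle (avg (D n) (fun i => X n i ^ a * partialProduct S (valuations i) ^ b))
    (u a * c S) (u a * c')
  linarith

/-! ### The limiting product of geometric variables -/

section Geometric

variable {r : ℕ} {Ω' : Type*} [MeasurableSpace Ω'] {μ : Measure Ω'}
  {G : Fin r → Nat.Primes → Ω' → ℕ}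

lemma measurable_primeFactorTerm (hG : ∀ k p, Measurable (G k p)) (p : Nat.Primes) :
    Measurable fun ω => primeFactorTerm (fun k q => G k q ω) p := by
  have h : Measurable fun ω => fun k => G k p ω := measurable_pi_lambda _ fun k => hG k p
  exact (measurable_of_countable fun g : Fin r → ℕ => (((p : ℕ) : ℝ) ^
    (((Finset.univ.sup fun k => g k : ℕ) : ℤ) - ((∑ k, g k : ℕ) : ℤ)))).comp h

lemma measurable_partialProduct (hG : ∀ k p, Measurable (G k p)) (S : Finset Nat.Primes) :
    Measurable fun ω => partialProduct S fun k p => G k p ω :=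
  Finset.measurable_fun_prod _ fun p _ => measurable_primeFactorTerm hG p

lemma tendsto_partialProduct_primeProduct (g : Fin r → Nat.Primes → ℕ) :
    Tendsto (fun S => partialProduct S g) atTop (𝓝 (primeProduct g)) :=
  (multipliable_primeFactorTerm g).hasProd

lemma primeProduct_nonneg (g : Fin r → Nat.Primes → ℕ) : 0 ≤ primeProduct g :=
  ge_of_tendsto' (tendsto_partialProduct_primeProduct g) fun S => partialProduct_nonneg S g

lemma primeProduct_le_one (g : Fin r → Nat.Primes → ℕ) : primeProduct g ≤ 1 :=
  le_of_tendsto' (tendsto_partialProduct_primeProduct g) fun S => partialProduct_le_one S g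

lemma measurable_primeProduct (hG : ∀ k p, Measurable (G k p)) :
    Measurable fun ω => primeProduct fun k p => G k p ω :=
  measurable_of_tendsto_metrizable' atTop (measurable_partialProduct hG)
    (tendsto_pi_nhds.2 fun ω => tendsto_partialProduct_primeProduct fun k p => G k p ω)

lemma tendsto_integral_partialProduct [IsProbabilityMeasure μ]
    (hG : ∀ k p, Measurable (G k p)) (b : ℕ) :
    Tendsto (fun S => ∫ ω, partialProduct S (fun k p => G k p ω) ^ b ∂μ) atTop
      (𝓝 (∫ ω, primeProduct (fun k p => G k p ω) ^ b ∂μ)) := by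
  refine tendsto_integral_filter_of_dominated_convergence (fun _ => 1)
    (Eventually.of_forall fun S =>
      ((measurable_partialProduct hG S).pow_const b).aestronglyMeasurable)
    (Eventually.of_forall fun S => Eventually.of_forall fun ω => ?_) (integrable_const _)
    (Eventually.of_forall fun ω => (tendsto_partialProduct_primeProduct _).pow b)
  rw [Real.norm_eq_abs, abs_of_nonneg (pow_nonneg (partialProduct_nonneg _ _) b)]
  exact pow_le_one₀ (partialProduct_nonneg _ _) (partialProduct_le_one _ _)

lemma measurable_restrictExp (hG : ∀ k p, Measurable (G k p))
    (S : Finset Nat.Primes) :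
    Measurable fun ω => restrictExp S fun k p => G k p ω :=
  measurable_pi_lambda _ fun x => hG x.1 x.2

lemma map_restrictExp_singleton (hG : ∀ k p, Measurable (G k p))
    (hGgeom : ∀ k p (j : ℕ), μ.real {ω | G k p ω = j} =
      (1 - 1 / ((p : ℕ) : ℝ)) * (1 / ((p : ℕ) : ℝ) ^ j))
    (hGindep : iIndepFun (fun kp : Fin r × Nat.Primes => G kp.1 kp.2) μ)
    (S : Finset Nat.Primes) (e : Fin r × S → ℕ) :
    (μ.map fun ω => restrictExp S fun k p => G k p ω).real {e} = geomWeight S e := by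
  have hinj : Function.Injective fun x : Fin r × S => (x.1, (x.2 : Nat.Primes)) := by
    rintro ⟨k, p⟩ ⟨l, q⟩ h
    simp only [Prod.mk.injEq] at h
    exact Prod.ext h.1 (Subtype.ext h.2)
  have hind := (hGindep.precomp hinj).measure_inter_preimage_eq_mul Finset.univ
    (sets := fun x => {e x}) fun x _ => measurableSet_singleton _
  rw [map_measureReal_apply (measurable_restrictExp hG S) (measurableSet_singleton e)]
  have hset : (fun ω => restrictExp S fun k p => G k p ω) ⁻¹' {e} =
      ⋂ x ∈ (Finset.univ : Finset (Fin r × S)), (fun ω => G x.1 x.2 ω) ⁻¹' {e x} := by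
    ext ω
    simp [funext_iff, restrictExp]
  rw [hset, Measure.real]
  refine (congrArg ENNReal.toReal hind).trans ?_
  rw [ENNReal.toReal_prod]
  exact Finset.prod_congr rfl fun x _ => hGgeom x.1 x.2 (e x)

/-- The weights are the point masses of the law of the exponent vector, so their total is finite
without computing geometric series. -/
lemma summable_geomWeight [IsProbabilityMeasure μ]
    (hG : ∀ k p, Measurable (G k p))
    (hGgeom : ∀ k p (j : ℕ), μ.real {ω | G k p ω = j} =
      (1 - 1 / ((p : ℕ) : ℝ)) * (1 / ((p : ℕ) : ℝ) ^ j))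
    (hGindep : iIndepFun (fun kp : Fin r × Nat.Primes => G kp.1 kp.2) μ)
    (S : Finset Nat.Primes) : Summable (geomWeight (r := r) S) := by
  have : Summable fun e : Fin r × S → ℕ =>
      (μ.map fun ω => restrictExp S fun k p => G k p ω).real {e} := by
    refine ENNReal.summable_toReal ?_
    have hp : IsProbabilityMeasure (μ.map fun ω => restrictExp S fun k p => G k p ω) :=
      Measure.isProbabilityMeasure_map (measurable_restrictExp hG S).aemeasurable
    rw [← measure_iUnion (fun e e' h => by simpa using h) fun e => measurableSet_singleton e]
    exact measure_ne_top _ _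
  simpa only [map_restrictExp_singleton hG hGgeom hGindep S] using this

lemma integral_partialProduct [IsProbabilityMeasure μ]
    (hG : ∀ k p, Measurable (G k p))
    (hGgeom : ∀ k p (j : ℕ), μ.real {ω | G k p ω = j} =
      (1 - 1 / ((p : ℕ) : ℝ)) * (1 / ((p : ℕ) : ℝ) ^ j))
    (hGindep : iIndepFun (fun kp : Fin r × Nat.Primes => G kp.1 kp.2) μ)
    (S : Finset Nat.Primes) (b : ℕ) :
    ∫ ω, partialProduct S (fun k p => G k p ω) ^ b ∂μ =
      ∑' e : Fin r × S → ℕ, geomWeight S e * partialProduct S (extendExp S e) ^ b := by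
  have hm : Measurable fun e : Fin r × S → ℕ => partialProduct S (extendExp S e) ^ b :=
    measurable_of_countable _
  have hp : IsProbabilityMeasure (μ.map fun ω => restrictExp S fun k p => G k p ω) :=
    Measure.isProbabilityMeasure_map (measurable_restrictExp hG S).aemeasurable
  have h1 : ∫ ω, partialProduct S (fun k p => G k p ω) ^ b ∂μ =
      ∫ e, partialProduct S (extendExp S e) ^ b
        ∂(μ.map fun ω => restrictExp S fun k p => G k p ω) := by
    rw [integral_map (measurable_restrictExp hG S).aemeasurable hm.aestronglyMeasurable]
    simp only [partialProduct_extendExp]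
  rw [h1, integral_countable]
  · simp only [map_restrictExp_singleton hG hGgeom hGindep S, smul_eq_mul]
  · refine Integrable.of_bound hm.aestronglyMeasurable 1 (Eventually.of_forall fun e => ?_)
    rw [Real.norm_eq_abs, abs_of_nonneg (pow_nonneg (partialProduct_nonneg _ _) b)]
    exact pow_le_one₀ (partialProduct_nonneg _ _) (partialProduct_le_one _ _)

/-- The joint moments of the weight and of the ratio of the least common multiple to the product
converge to products of moments. -/
lemma IsAdmissible.tendsto_moments [IsProbabilityMeasure μ]
    (hG : ∀ k p, Measurable (G k p))
    (hGgeom : ∀ k p (j : ℕ), μ.real {ω | G k p ω = j} =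
      (1 - 1 / ((p : ℕ) : ℝ)) * (1 / ((p : ℕ) : ℝ) ^ j))
    (hGindep : iIndepFun (fun kp : Fin r × Nat.Primes => G kp.1 kp.2) μ)
    {D : ℕ → Finset (Fin r → ℕ)} {X : ℕ → (Fin r → ℕ) → ℝ}
    {u : ℕ → ℝ} (h : IsAdmissible D X u) (a b : ℕ) :
    Tendsto (fun n => avg (D n) (fun i => X n i ^ a * lcmOverProduct i ^ b)) atTop
      (𝓝 (u a * ∫ ω, primeProduct (fun k p => G k p ω) ^ b ∂μ)) := by
  refine h.tendsto_lcm a b _ _ (fun S => ?_) (tendsto_integral_partialProduct hG b)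
  rw [integral_partialProduct hG hGgeom hGindep]
  exact h.tendsto_partialProduct a b S (summable_geomWeight hG hGgeom hGindep S)

end Geometric

/-! ### The case `ℓ = r`: counting under the hyperbola -/

/-- The tuples of positive integers with product at most `n`. -/
def hyperbola (r n : ℕ) : Finset (Fin r → ℕ) :=
  {i ∈ Fintype.piFinset fun _ => Finset.Icc 1 n | ∏ k, i k ≤ n}

lemma mem_hyperbola {r n : ℕ} (i : Fin r → ℕ) :
    i ∈ hyperbola r n ↔ (∀ k, 1 ≤ i k) ∧ ∏ k, i k ≤ n := by
  simp only [hyperbola, Finset.mem_filter, Fintype.mem_piFinset, Finset.mem_Icc]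
  refine ⟨fun h => ⟨fun k => (h.1 k).1, h.2⟩, fun h => ⟨fun k => ⟨h.1 k, ?_⟩, h.2⟩⟩
  exact (Finset.single_le_prod' (fun j _ => h.1 j) (Finset.mem_univ k)).trans h.2

lemma card_hyperbola_zero {n : ℕ} (hn : 1 ≤ n) : (hyperbola 0 n).card = 1 := by
  simp [hyperbola, hn]

lemma one_le_prod_of_mem_hyperbola {r n : ℕ} {i : Fin r → ℕ} (hi : i ∈ hyperbola r n) :
    1 ≤ ∏ k, i k := by
  simp only [hyperbola, Finset.mem_filter, Fintype.mem_piFinset, Finset.mem_Icc] at hi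
  exact Finset.one_le_prod' fun k _ => (hi.1 k).1

/-- Summation over the hyperbolic region along one coordinate. -/
lemma sum_hyperbola_succ {r n : ℕ} (k : Fin (r + 1))
    (F : (Fin (r + 1) → ℕ) → ℝ) :
    ∑ i ∈ hyperbola (r + 1) n, F i =
      ∑ i ∈ hyperbola r n, ∑ v ∈ Finset.Icc 1 (n / ∏ j, i j), F (Fin.insertNth k v i) := by
  rw [Finset.sum_sigma']
  refine Finset.sum_bij' (fun i _ => ⟨fun j => i (k.succAbove j), i k⟩)
    (fun x _ => Fin.insertNth k x.2 x.1) ?_ ?_ ?_ ?_ ?_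
  · intro i hi
    rw [mem_hyperbola _, Fin.prod_univ_succAbove _ k] at hi
    have hpos : 0 < ∏ j, i (k.succAbove j) := Finset.prod_pos fun j _ => hi.1 _
    rw [Finset.mem_sigma, mem_hyperbola _, Finset.mem_Icc, Nat.le_div_iff_mul_le hpos]
    exact ⟨⟨fun j => hi.1 _, (Nat.le_mul_of_pos_left _ (hi.1 k)).trans hi.2⟩, hi.1 k, hi.2⟩
  · rintro ⟨i, v⟩ hx
    rw [Finset.mem_sigma, Finset.mem_Icc] at hx
    have hpos : 0 < ∏ j, i j := one_le_prod_of_mem_hyperbola hx.1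
    rw [mem_hyperbola _, Nat.le_div_iff_mul_le hpos] at hx
    rw [mem_hyperbola _, Fin.prod_univ_succAbove _ k, Fin.forall_iff_succAbove k]
    simpa using ⟨⟨hx.2.1, hx.1.1⟩, hx.2.2⟩
  · intro i _
    exact Fin.insertNth_self_removeNth k i
  · rintro ⟨i, v⟩ _
    simp
  · intro i _
    exact congrArg F (Fin.insertNth_self_removeNth k i).symm

lemma card_hyperbola_succ {r n : ℕ} :
    ((hyperbola (r + 1) n).card : ℝ) = ∑ i ∈ hyperbola r n, ((n / ∏ j, i j : ℕ) : ℝ) := by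
  have := sum_hyperbola_succ (r := r) (n := n) 0 (fun _ => 1)
  simpa using this

/-- A coordinate equal to 1 drops out of the product, so the faces are hyperbolic regions of one
dimension less. -/
lemma card_face_hyperbola {r n : ℕ} (k : Fin (r + 1)) :
    (({i ∈ hyperbola (r + 1) n | i k = 1}.card : ℕ) : ℝ) = (hyperbola r n).card := by
  have h := sum_hyperbola_succ (r := r) (n := n) k (fun i => if i k = 1 then 1 else 0)
  rw [Finset.sum_boole] at h
  rw [h, Finset.cast_card]
  refine Finset.sum_congr rfl fun i hi => ?_
  have hpos : 0 < ∏ j, i j := one_le_prod_of_mem_hyperbola hi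
  have h1 : 1 ≤ n / ∏ j, i j := by
    rw [Nat.le_div_iff_mul_le hpos, one_mul]
    exact ((mem_hyperbola _).1 hi).2
  simp [h1]

lemma hyperbola_mono {r m n : ℕ} (h : m ≤ n) : hyperbola r m ⊆ hyperbola r n := by
  intro i hi
  simp only [hyperbola, Finset.mem_filter, Fintype.mem_piFinset, Finset.mem_Icc] at hi ⊢
  exact ⟨fun k => ⟨(hi.1 k).1, (hi.1 k).2.trans h⟩, hi.2.trans h⟩

/-- Both counts are sums of quotients over `hyperbola r n`, and division by `j` with rounding loses
less than 1 per term. Points leaving the smaller region contribute zero. -/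
lemma card_hyperbola_div_ge {r n j : ℕ} (hj : 1 ≤ j) (hjn : j ≤ n) :
    ((hyperbola (r + 1) n).card : ℝ) / j - (hyperbola r n).card ≤
      (hyperbola (r + 1) (n / j)).card := by
  have hn : 1 ≤ n := hj.trans hjn
  have hnj : 1 ≤ n / j := (Nat.le_div_iff_mul_le hj).2 (by simpa using hjn)
  have hj0 : (0 : ℝ) < j := by exact_mod_cast hj
  have h1 : ((hyperbola (r + 1) (n / j)).card : ℝ) =
      ∑ i ∈ hyperbola r n, ((n / (∏ l, i l) / j : ℕ) : ℝ) := by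
    rw [card_hyperbola_succ]
    have e : ∀ i : Fin r → ℕ, n / j / ∏ l, i l = n / (∏ l, i l) / j := fun i => by
      rw [Nat.div_div_eq_div_mul, Nat.div_div_eq_div_mul, mul_comm]
    simp only [e]
    refine Finset.sum_subset (hyperbola_mono (Nat.div_le_self n j)) fun i hi hi' => ?_
    rw [mem_hyperbola _] at hi'
    have : n / j < ∏ l, i l := by
      by_contra h
      exact hi' ⟨((mem_hyperbola _).1 hi).1, not_lt.1 h⟩
    rw [← e, Nat.div_eq_of_lt this, Nat.cast_zero]
  rw [h1, card_hyperbola_succ, Finset.cast_card, Finset.sum_div, ← Finset.sum_sub_distrib]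
  refine Finset.sum_le_sum fun i _ => ?_
  have h2 : n / (∏ l, i l) < (n / (∏ l, i l) / j + 1) * j := by
    have := Nat.lt_div_mul_add hj (a := n / ∏ l, i l)
    linarith
  have h3 : ((n / ∏ l, i l : ℕ) : ℝ) < ((n / (∏ l, i l) / j : ℕ) + 1 : ℝ) * j := by
    exact_mod_cast h2
  have h4 := (div_lt_iff₀ hj0).2 h3
  linarith

/-- The left side counts the points whose first coordinate `j` is at most `J`. -/
lemma sum_card_hyperbola_div_le {r n J : ℕ} (hJ : J ≤ n) :
    ∑ j ∈ Finset.Icc 1 J, ((hyperbola r (n / j)).card : ℝ) ≤ (hyperbola (r + 1) n).card := by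
  rw [← Nat.cast_sum, ← Finset.card_sigma]
  refine Nat.cast_le.2 (Finset.card_le_card_of_injOn
    (fun x : (Σ _ : ℕ, Fin r → ℕ) => (Fin.cons x.1 x.2 : Fin (r + 1) → ℕ)) ?_ ?_)
  · rintro ⟨j, i⟩ hx
    simp only [Finset.coe_sigma, Set.mem_sigma_iff, Finset.mem_coe, Finset.mem_Icc] at hx
    have hn : 1 ≤ n := hx.1.1.trans (hx.1.2.trans hJ)
    have hnj : 1 ≤ n / j := (Nat.le_div_iff_mul_le hx.1.1).2 (by
      simpa using hx.1.2.trans hJ)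
    rw [mem_hyperbola _, Nat.le_div_iff_mul_le hx.1.1] at hx
    rw [Finset.mem_coe, mem_hyperbola _, Fin.prod_univ_succ, Fin.forall_fin_succ]
    rw [mul_comm] at hx
    simpa using ⟨⟨hx.1.1, hx.2.1⟩, hx.2.2⟩
  · rintro ⟨j, i⟩ _ ⟨j', i'⟩ _ h
    have h' := Fin.cons_inj.1 h
    obtain ⟨rfl, rfl⟩ := h'
    rfl

lemma card_hyperbola_pos (r : ℕ) {n : ℕ} (hn : 1 ≤ n) : (0 : ℝ) < (hyperbola r n).card := by
  have : (hyperbola r n).Nonempty := ⟨fun _ => 1, (mem_hyperbola _).2 ⟨fun _ => le_rfl, by simpa⟩⟩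
  exact_mod_cast this.card_pos

/-- Adding a coordinate increases the order of magnitude of the number of points. -/
lemma tendsto_card_hyperbola_ratio (r : ℕ) :
    Tendsto (fun n => ((hyperbola (r + 1) n).card : ℝ) / (hyperbola r n).card) atTop atTop := by
  induction r with
  | zero =>
    refine tendsto_natCast_atTop_atTop.congr' ?_
    filter_upwards [eventually_ge_atTop 1] with n hn
    rw [card_hyperbola_succ, Finset.sum_congr rfl (g := fun _ => (n : ℝ)) (by simp)]
    simp [card_hyperbola_zero hn]
  | succ r ih =>
    rw [tendsto_atTop]
    intro B
    -- The harmonic sum up to `J` multiplies the count by at least `B + 1`. The rounding loss, `J`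
    -- times the count two dimensions down, is at most one copy of the count by the induction
    -- hypothesis, which leaves `B`.
    obtain ⟨J, hJ⟩ := ((tendsto_atTop.1 Real.tendsto_sum_range_one_div_nat_succ_atTop)
      (B + 1)).exists
    filter_upwards [eventually_ge_atTop (J + 1), (tendsto_atTop.1 ih) J] with n hn hr
    have hn1 : 1 ≤ n := by omega
    have hp0 := card_hyperbola_pos r hn1
    have hp1 := card_hyperbola_pos (r + 1) hn1
    rw [le_div_iff₀ hp0] at hr
    rw [le_div_iff₀ hp1]
    refine le_trans ?_ (sum_card_hyperbola_div_le (J := J) (by omega))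
    have h1 : ∑ j ∈ Finset.Icc 1 J, (((hyperbola (r + 1) n).card : ℝ) / j - (hyperbola r n).card) ≤
        ∑ j ∈ Finset.Icc 1 J, ((hyperbola (r + 1) (n / j)).card : ℝ) :=
      Finset.sum_le_sum fun j hj => by
        rw [Finset.mem_Icc] at hj
        exact card_hyperbola_div_ge hj.1 (by omega)
    refine le_trans ?_ h1
    have h2 : ∑ j ∈ Finset.Icc 1 J, (((hyperbola (r + 1) n).card : ℝ) / j) =
        (hyperbola (r + 1) n).card * ∑ i ∈ Finset.range J, 1 / ((i : ℝ) + 1) := by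
      rw [Finset.mul_sum, ← Finset.Ico_add_one_right_eq_Icc, Finset.sum_Ico_eq_sum_range]
      refine Finset.sum_congr (by simp) fun i _ => ?_
      push_cast
      ring
    rw [Finset.sum_sub_distrib, h2, Finset.sum_const, Nat.card_Icc, nsmul_eq_mul]
    simp only [add_tsub_cancel_right]
    nlinarith

/-- The sum is compared with the integral of `t ^ a`. The upper estimate loses only the last term,
at most 1 after division by `y ^ a`; the lower one loses only through `N < y`. -/
lemma abs_sum_pow_div_sub_le (a N : ℕ) (y : ℝ) (hN : 1 ≤ N) (h1 : N ≤ y) (h2 : y < N + 1) :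
    |∑ v ∈ Finset.Icc 1 N, ((v : ℝ) / y) ^ a - N / (a + 1)| ≤ 1 := by
  have hN0 : (1 : ℝ) ≤ N := by exact_mod_cast hN
  have hy : 0 < y := by linarith
  have hmono : MonotoneOn (fun t : ℝ => t ^ a) (Set.Icc 0 (0 + (N : ℝ))) :=
    fun s hs t _ hst => pow_le_pow_left₀ hs.1 hst a
  have hI : ∫ t in (0 : ℝ)..0 + (N : ℝ), t ^ a = (N : ℝ) ^ (a + 1) / (a + 1) := by
    rw [integral_pow]; simp
  have l1 := hmono.integral_le_sum
  have l2 := hmono.sum_le_integral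
  rw [hI] at l1 l2
  simp only [zero_add] at l1 l2
  have hS : ∑ v ∈ Finset.Icc 1 N, (v : ℝ) ^ a = ∑ i ∈ Finset.range N, ((i + 1 : ℕ) : ℝ) ^ a := by
    rw [← Finset.Ico_add_one_right_eq_Icc, Finset.sum_Ico_eq_sum_range]
    exact Finset.sum_congr (by simp) fun i _ => by rw [add_comm]
  have hS2 : ∑ i ∈ Finset.range N, ((i + 1 : ℕ) : ℝ) ^ a ≤
      ∑ i ∈ Finset.range N, (i : ℝ) ^ a + (N : ℝ) ^ a := by
    rw [← Finset.sum_range_succ (fun i : ℕ => (i : ℝ) ^ a), Finset.sum_range_succ']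
    have : (0 : ℝ) ≤ ((0 : ℕ) : ℝ) ^ a := by positivity
    linarith
  have hsum : ∑ v ∈ Finset.Icc 1 N, ((v : ℝ) / y) ^ a =
      (∑ i ∈ Finset.range N, ((i + 1 : ℕ) : ℝ) ^ a) / y ^ a := by
    rw [← hS, Finset.sum_div]
    exact Finset.sum_congr rfl fun v _ => div_pow _ _ _
  have hx0 : 0 ≤ (N : ℝ) / y := by positivity
  have hx1 : (N : ℝ) / y ≤ 1 := (div_le_one hy).2 h1
  have hpow1 : ((N : ℝ) / y) ^ a ≤ 1 := pow_le_one₀ hx0 hx1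
  -- Bernoulli's inequality bounds the effect of replacing `N` by `y`; since `y - N < 1`, it costs
  -- at most `a / (a + 1)` in total.
  have hbern : 1 - a * (1 - (N : ℝ) / y) ≤ ((N : ℝ) / y) ^ a := by
    have := one_add_mul_le_pow (a := (N : ℝ) / y - 1) (by linarith) a
    rw [add_sub_cancel] at this
    linarith
  have hfrac : (N : ℝ) * (1 - (N : ℝ) / y) ≤ 1 := by
    have : 1 - (N : ℝ) / y = (y - N) / y := by field_simp
    rw [this, mul_div_assoc', div_le_one hy]
    nlinarith
  have ha : (0 : ℝ) ≤ a := Nat.cast_nonneg a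
  have ha1 : (0 : ℝ) < a + 1 := by positivity
  have e1 : (N : ℝ) ^ (a + 1) / (a + 1) / y ^ a = N / (a + 1) * (N / y) ^ a := by
    rw [div_pow, pow_succ]; field_simp
  have e2 : (N : ℝ) ^ a / y ^ a = (N / y) ^ a := (div_pow _ _ _).symm
  have hya : 0 < y ^ a := by positivity
  rw [hsum, abs_le]
  constructor
  · have h3 := div_le_div_of_nonneg_right l1 hya.le
    rw [e1] at h3
    have h4 : (N : ℝ) / (a + 1) * (1 - a * (1 - (N : ℝ) / y)) ≤ N / (a + 1) * (N / y) ^ a :=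
      mul_le_mul_of_nonneg_left hbern (by positivity)
    have h5 : (N : ℝ) / (a + 1) * (1 - a * (1 - (N : ℝ) / y)) =
        N / (a + 1) - a / (a + 1) * (N * (1 - (N : ℝ) / y)) := by ring
    have h6 : (a : ℝ) / (a + 1) * (N * (1 - (N : ℝ) / y)) ≤ 1 := by
      have : (a : ℝ) / (a + 1) ≤ 1 := (div_le_one ha1).2 (by linarith)
      have h7 : 0 ≤ (N : ℝ) * (1 - (N : ℝ) / y) := mul_nonneg (by linarith) (by linarith)
      exact mul_le_one₀ this h7 hfrac
    linarith
  · have h3 := div_le_div_of_nonneg_right (hS2.trans (add_le_add_left l2 _)) hya.le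
    rw [add_div, e1, e2] at h3
    have h4 : (N : ℝ) / (a + 1) * (N / y) ^ a ≤ N / (a + 1) :=
      mul_le_of_le_one_right (by positivity) hpow1
    linarith

/-- Along one coordinate `v` the scaled product is `v / y`, with `y` equal to `n` over the product
of the others. Each fibre has error at most 1, so the number of fibres bounds the total. -/
lemma abs_sum_hyperbola_sub_le {r n : ℕ} (hn : 1 ≤ n) (a : ℕ) :
    |∑ i ∈ hyperbola (r + 1) n, ((∏ k, (i k : ℝ)) / n) ^ a -
      (hyperbola (r + 1) n).card / ((a : ℝ) + 1)| ≤ (hyperbola r n).card := by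
  have hn0 : (0 : ℝ) < n := by exact_mod_cast hn
  rw [sum_hyperbola_succ 0, card_hyperbola_succ, Finset.sum_div, ← Finset.sum_sub_distrib]
  refine (Finset.abs_sum_le_sum_abs _ _).trans ?_
  rw [Finset.cast_card]
  refine Finset.sum_le_sum fun i hi => ?_
  have hpos : 0 < ∏ j, i j := one_le_prod_of_mem_hyperbola hi
  have hposR : (0 : ℝ) < ((∏ j, i j : ℕ) : ℝ) := by exact_mod_cast hpos
  have e : ∀ v : ℕ, (∏ k, ((Fin.insertNth (α := fun _ => ℕ) 0 v i k : ℕ) : ℝ)) / n =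
      v / (n / ((∏ j, i j : ℕ) : ℝ)) := by
    intro v
    rw [Fin.prod_univ_succAbove _ 0]
    simp only [Fin.insertNth_apply_same, Fin.insertNth_apply_succAbove]
    push_cast
    field_simp
  simp only [e]
  refine abs_sum_pow_div_sub_le a _ _ ?_ Nat.cast_div_le ?_
  · rw [Nat.le_div_iff_mul_le hpos, one_mul]
    exact ((mem_hyperbola _).1 hi).2
  · rw [div_lt_iff₀ hposR]
    have := Nat.lt_div_mul_add hpos (a := n)
    have h : n < (n / (∏ j, i j) + 1) * ∏ j, i j := by linarith
    exact_mod_cast h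

/-! ### Elementary symmetric polynomials and Maclaurin's inequality -/

lemma symPoly_mono {R : Type*} [CommSemiring R] [PartialOrder R] [IsOrderedRing R] (ℓ r : ℕ)
    {x y : Fin r → R} (hx : ∀ k, 0 ≤ x k) (hxy : x ≤ y) : symPoly ℓ r x ≤ symPoly ℓ r y :=
  Finset.sum_le_sum fun _ _ => Finset.prod_le_prod (fun k _ => hx k) fun k _ => hxy k

lemma symPoly_self {R : Type*} [CommSemiring R] (r : ℕ) (x : Fin r → R) :
    symPoly r r x = ∏ k, x k := by
  have : Finset.powersetCard r (Finset.univ : Finset (Fin r)) = {Finset.univ} := by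
    simpa using Finset.powersetCard_self (Finset.univ : Finset (Fin r))
  rw [symPoly, this, Finset.sum_singleton]

lemma symPoly_smul {R : Type*} [CommSemiring R] (ℓ r : ℕ) (c : R) (x : Fin r → R) :
    symPoly ℓ r (fun k => c * x k) = c ^ ℓ * symPoly ℓ r x := by
  rw [symPoly, symPoly, Finset.mul_sum]
  refine Finset.sum_congr rfl fun t ht => ?_
  rw [Finset.prod_mul_distrib, Finset.prod_const, (Finset.mem_powersetCard.1 ht).2]

lemma symPoly_cast (ℓ r : ℕ) (x : Fin r → ℕ) :
    ((symPoly ℓ r x : ℕ) : ℝ) = symPoly ℓ r fun k => (x k : ℝ) := by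
  simp [symPoly]

lemma symPoly_one (ℓ r : ℕ) : symPoly ℓ r (fun _ => (1 : ℕ)) = r.choose ℓ := by
  simp [symPoly]

lemma continuous_symPoly (ℓ r : ℕ) : Continuous (symPoly ℓ r : (Fin r → ℝ) → ℝ) := by
  unfold symPoly; fun_prop

lemma card_powersetCard_filter_mem {r ℓ : ℕ} (i : Fin (r + 1)) :
    ({t ∈ Finset.powersetCard (ℓ + 1) (Finset.univ : Finset (Fin (r + 1))) | i ∈ t}).card =
      r.choose ℓ := by
  simpa using Finset.card_filter_powersetCard_subset {i} Finset.univ (ℓ + 1) (by simp) (by simp)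

/-- Maclaurin's inequality between the elementary symmetric polynomial and the product. -/
lemma prod_rpow_le_symPoly {ℓ r : ℕ} (hℓ : 1 ≤ ℓ) (hℓr : ℓ ≤ r) {y : Fin r → ℝ}
    (hy : ∀ k, 0 ≤ y k) :
    (∏ k, y k) ^ ((ℓ : ℝ) / r) ≤ symPoly ℓ r y / (r.choose ℓ : ℝ) := by
  obtain ⟨r, rfl⟩ : ∃ s, r = s + 1 := ⟨r - 1, by omega⟩
  obtain ⟨ℓ, rfl⟩ : ∃ s, ℓ = s + 1 := ⟨ℓ - 1, by omega⟩
  have hC : (0 : ℝ) < ((r + 1).choose (ℓ + 1) : ℝ) := by exact_mod_cast Nat.choose_pos hℓr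
  set s := Finset.powersetCard (ℓ + 1) (Finset.univ : Finset (Fin (r + 1))) with hs
  have hcard : s.card = (r + 1).choose (ℓ + 1) := by simp [hs]
  -- Equal-weight AM-GM over the products that make up the symmetric polynomial; each coordinate
  -- occurs in `r.choose ℓ` of them, in the shifted indices.
  have h := Real.geom_mean_le_arith_mean_weighted s
    (fun _ => (((r + 1).choose (ℓ + 1) : ℕ) : ℝ)⁻¹) (fun t => ∏ i ∈ t, y i)
    (fun _ _ => by positivity) (by
      rw [Finset.sum_const, hcard, nsmul_eq_mul, mul_inv_cancel₀ hC.ne'])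
    fun t _ => Finset.prod_nonneg fun i _ => hy i
  rw [← Finset.mul_sum, ← div_eq_inv_mul, Real.finsetProd_rpow] at h
  · have e : ∏ t ∈ s, ∏ i ∈ t, y i = (∏ i, y i) ^ (r.choose ℓ) := by
      rw [Finset.prod_comm' (t' := Finset.univ) (s' := fun i => {t ∈ s | i ∈ t}) (by simp),
        ← Finset.prod_pow]
      refine Finset.prod_congr rfl fun i _ => ?_
      rw [Finset.prod_const, card_powersetCard_filter_mem]
    rw [e, ← Real.rpow_natCast, ← Real.rpow_mul (Finset.prod_nonneg fun i _ => hy i)] at h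
    have e2 : (r.choose ℓ : ℝ) * (((r + 1).choose (ℓ + 1) : ℕ) : ℝ)⁻¹ =
        ((ℓ + 1 : ℕ) : ℝ) / ((r + 1 : ℕ) : ℝ) := by
      have h3 : ((r + 1 : ℕ) : ℝ) * (r.choose ℓ : ℝ) =
          ((r + 1).choose (ℓ + 1) : ℝ) * ((ℓ + 1 : ℕ) : ℝ) := by
        exact_mod_cast Nat.add_one_mul_choose_eq r ℓ
      have h4 : ((r + 1 : ℕ) : ℝ) ≠ 0 := by positivity
      rw [← div_eq_mul_inv, div_eq_div_iff hC.ne' h4]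
      linarith
    rw [e2] at h
    exact h
  · exact fun t _ => Finset.prod_nonneg fun i _ => hy i

lemma prod_le_rpow {ℓ r : ℕ} (hℓ : 1 ≤ ℓ) (hℓr : ℓ ≤ r) {y : Fin r → ℝ} (hy : ∀ k, 0 ≤ y k)
    {c : ℝ} (hc : symPoly ℓ r y ≤ c) : ∏ k, y k ≤ (c / (r.choose ℓ : ℝ)) ^ ((r : ℝ) / ℓ) := by
  have hr0 : (r : ℝ) ≠ 0 := by exact_mod_cast (by omega : r ≠ 0)
  have hl0 : (ℓ : ℝ) ≠ 0 := by exact_mod_cast (by omega : ℓ ≠ 0)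
  have hp : 0 ≤ ∏ k, y k := Finset.prod_nonneg fun k _ => hy k
  have h1 := (prod_rpow_le_symPoly hℓ hℓr hy).trans
    (div_le_div_of_nonneg_right hc (Nat.cast_nonneg _))
  have h2 := Real.rpow_le_rpow (Real.rpow_nonneg hp _) h1 (by positivity : 0 ≤ (r : ℝ) / ℓ)
  rwa [← Real.rpow_mul hp, div_mul_div_comm, mul_comm, div_self (mul_ne_zero hr0 hl0),
    Real.rpow_one] at h2

/-! ### The discrete region and its scaled product -/

/-- The discrete region as a finite set. -/
noncomputable def region {ℓ r : ℕ} (hℓ : 1 ≤ ℓ) (hℓr : ℓ ≤ r) (n : ℕ) : Finset (Fin r → ℕ) :=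
  (discreteRegion_finite hℓ hℓr n).toFinset

/-- The product of the coordinates divided by `n ^ (r / ℓ)`. -/
noncomputable def scaledProduct (ℓ n : ℕ) {r : ℕ} (i : Fin r → ℕ) : ℝ :=
  (∏ k, (i k : ℝ)) / (n : ℝ) ^ ((r : ℝ) / (ℓ : ℝ))

lemma mem_region {ℓ r : ℕ} (hℓ : 1 ≤ ℓ) (hℓr : ℓ ≤ r) {n : ℕ} {i : Fin r → ℕ} :
    i ∈ region hℓ hℓr n ↔ (∀ k, 1 ≤ i k) ∧ symPoly ℓ r i ≤ n := by
  simp [region, discreteRegion]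

lemma isDownRegion_region {ℓ r : ℕ} (hℓ : 1 ≤ ℓ) (hℓr : ℓ ≤ r) (n : ℕ) :
    IsDownRegion (region hℓ hℓr n) where
  pos _ hi := ((mem_region hℓ hℓr).1 hi).1
  down _ hi _ hj hji := (mem_region hℓ hℓr).2
    ⟨hj, (symPoly_mono ℓ r (fun _ => Nat.zero_le _) hji).trans ((mem_region hℓ hℓr).1 hi).2⟩

lemma region_nonempty {ℓ r : ℕ} (hℓ : 1 ≤ ℓ) (hℓr : ℓ ≤ r) {n : ℕ} (hn : r.choose ℓ ≤ n) :
    (region hℓ hℓr n).Nonempty :=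
  ⟨fun _ => 1, (mem_region hℓ hℓr).2 ⟨fun _ => le_rfl, (symPoly_one ℓ r).trans_le hn⟩⟩

lemma scaledProduct_nonneg (ℓ n : ℕ) {r : ℕ} (i : Fin r → ℕ) : 0 ≤ scaledProduct ℓ n i := by
  unfold scaledProduct; positivity

lemma scaledProduct_le_one {ℓ r : ℕ} (hℓ : 1 ≤ ℓ) (hℓr : ℓ ≤ r) {n : ℕ} {i : Fin r → ℕ}
    (hi : i ∈ region hℓ hℓr n) : scaledProduct ℓ n i ≤ 1 := by
  refine div_le_one_of_le₀ ?_ (by positivity)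
  have h : symPoly ℓ r (fun k => (i k : ℝ)) ≤ n := by
    rw [← symPoly_cast]
    exact_mod_cast ((mem_region hℓ hℓr).1 hi).2
  refine (prod_le_rpow hℓ hℓr (fun k => Nat.cast_nonneg _) h).trans ?_
  refine Real.rpow_le_rpow (by positivity) (div_le_self (Nat.cast_nonneg _) ?_) (by positivity)
  exact_mod_cast Nat.choose_pos hℓr

lemma scaledProduct_mono (ℓ n : ℕ) {r : ℕ} {i j : Fin r → ℕ} (h : j ≤ i) :
    scaledProduct ℓ n j ≤ scaledProduct ℓ n i :=
  div_le_div_of_nonneg_right (Finset.prod_le_prod (fun _ _ => Nat.cast_nonneg _)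
    fun k _ => Nat.cast_le.2 (h k)) (by positivity)

lemma isAdmissible_region {ℓ r : ℕ} (hℓ : 1 ≤ ℓ) (hℓr : ℓ ≤ r) {u : ℕ → ℝ}
    (hface : ∀ k, Tendsto (fun n => faceRatio (region hℓ hℓr n) k) atTop (𝓝 0))
    (hu : ∀ a, Tendsto (fun n => avg (region hℓ hℓr n) fun i => scaledProduct ℓ n i ^ a) atTop
      (𝓝 (u a))) :
    IsAdmissible (region hℓ hℓr) (fun n => scaledProduct ℓ n) u where
  region := isDownRegion_region hℓ hℓr
  face := hface
  nonneg n i _ := scaledProduct_nonneg ℓ n i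
  le_one _ _ := scaledProduct_le_one hℓ hℓr
  mono n _ _ _ _ := scaledProduct_mono ℓ n
  moment := hu

lemma region_self_eq {r : ℕ} (hr : 1 ≤ r) (n : ℕ) : region hr le_rfl n = hyperbola r n := by
  ext i
  rw [mem_region, mem_hyperbola, symPoly_self]

lemma isAdmissible_region_self {r : ℕ} (hr : 1 ≤ r) :
    IsAdmissible (region hr le_rfl) (fun n => scaledProduct (r := r) r n)
      fun a => 1 / ((a : ℝ) + 1) := by
  obtain ⟨r, rfl⟩ : ∃ s, r = s + 1 := ⟨r - 1, by omega⟩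
  have hinv : Tendsto (fun n => ((hyperbola r n).card : ℝ) / (hyperbola (r + 1) n).card) atTop
      (𝓝 0) := by
    exact (tendsto_card_hyperbola_ratio r).inv_tendsto_atTop.congr fun n => inv_div _ _
  refine isAdmissible_region hr le_rfl (fun k => ?_) fun a => ?_
  · refine hinv.congr fun n => ?_
    classical
    rw [faceRatio, region_self_eq, ← card_face_hyperbola k]
  · rw [tendsto_iff_dist_tendsto_zero]
    refine squeeze_zero' (Eventually.of_forall fun _ => dist_nonneg) ?_ hinv
    filter_upwards [eventually_ge_atTop 1] with n hn
    have hp := card_hyperbola_pos (r + 1) hn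
    have hs : ∀ i : Fin (r + 1) → ℕ, scaledProduct (r + 1) n i = (∏ k, (i k : ℝ)) / n := by
      intro i
      rw [scaledProduct, div_self (by positivity), Real.rpow_one]
    simp only [hs]
    rw [region_self_eq, avg, Real.dist_eq, le_div_iff₀ hp]
    nth_rewrite 2 [← abs_of_pos hp]
    rw [← abs_mul, sub_mul, div_mul_cancel₀ _ hp.ne', one_div_mul_eq_div]
    exact abs_sum_hyperbola_sub_le hn a

/-! ### Volume and boundary of the continuous region -/

lemma isClosed_continuousRegion (ℓ r : ℕ) (c : ℝ) : IsClosed (continuousRegion ℓ r c) := by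
  have : continuousRegion ℓ r c = (⋂ k, {y | 0 ≤ y k}) ∩ {y | symPoly ℓ r y ≤ c} := by
    ext y; simp [continuousRegion]
  rw [this]
  exact (isClosed_iInter fun k => isClosed_le continuous_const (continuous_apply k)).inter
    (isClosed_le (continuous_symPoly ℓ r) continuous_const)

lemma measurableSet_continuousRegion (ℓ r : ℕ) (c : ℝ) : MeasurableSet (continuousRegion ℓ r c) :=
  (isClosed_continuousRegion ℓ r c).measurableSet

open Pointwise in
lemma smul_continuousRegion {ℓ r : ℕ} {a : ℝ} (ha : 0 < a) (c : ℝ) :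
    a • continuousRegion ℓ r c = continuousRegion ℓ r (a ^ ℓ * c) := by
  ext y
  rw [Set.mem_smul_set_iff_inv_smul_mem₀ ha.ne']
  have h : symPoly ℓ r (a⁻¹ • y) = (a ^ ℓ)⁻¹ * symPoly ℓ r y := by
    rw [← inv_pow, ← symPoly_smul]; rfl
  simp only [continuousRegion, Set.mem_ofPred_eq, h, Pi.smul_apply, smul_eq_mul]
  rw [inv_mul_le_iff₀ (by positivity)]
  refine and_congr_left fun _ => forall_congr' fun k => ?_
  rw [mul_nonneg_iff_of_pos_left (inv_pos.2 ha)]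

open Pointwise in
lemma volume_continuousRegion {ℓ r : ℕ} (hℓ : 1 ≤ ℓ) {c : ℝ} (hc : 0 < c) :
    volume (continuousRegion ℓ r c) =
      ENNReal.ofReal (c ^ ((r : ℝ) / ℓ)) * volume (continuousRegion ℓ r 1) := by
  have hl0 : (ℓ : ℝ) ≠ 0 := by exact_mod_cast (by omega : ℓ ≠ 0)
  have ha : 0 < c ^ ((1 : ℝ) / ℓ) := Real.rpow_pos_of_pos hc _
  have h1 : (c ^ ((1 : ℝ) / ℓ)) ^ ℓ = c := by
    rw [← Real.rpow_natCast, ← Real.rpow_mul hc.le, one_div_mul_cancel hl0, Real.rpow_one]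
  have h2 : |(c ^ ((1 : ℝ) / ℓ)) ^ r| = c ^ ((r : ℝ) / ℓ) := by
    rw [abs_of_pos (by positivity), ← Real.rpow_natCast, ← Real.rpow_mul hc.le, one_div_mul_eq_div]
  have := smul_continuousRegion (ℓ := ℓ) (r := r) ha 1
  rw [h1, mul_one] at this
  rw [← this, Measure.addHaar_smul, Module.finrank_fin_fun, h2]

/-- The terms containing `y k` are part of a sum of nonnegative terms. This lowers both `ℓ` and `r`
in the induction for finite volume. -/
lemma mul_symPoly_succAbove_le (ℓ r : ℕ) (k : Fin (r + 1)) {y : Fin (r + 1) → ℝ}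
    (hy : ∀ j, 0 ≤ y j) :
    y k * symPoly ℓ r (fun j => y (k.succAbove j)) ≤ symPoly (ℓ + 1) (r + 1) y := by
  rw [symPoly, symPoly, Finset.mul_sum]
  have hk : ∀ t : Finset (Fin r), k ∉ t.map k.succAboveEmb := by
    intro t h
    obtain ⟨j, -, hj⟩ := Finset.mem_map.1 h
    exact Fin.succAbove_ne k j hj
  refine sum_le_sum_of_injOn (fun t => Finset.cons k (t.map k.succAboveEmb) (hk t)) ?_ ?_ ?_ ?_
  · intro s _ t _ hst
    refine Finset.map_injective k.succAboveEmb ?_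
    ext j
    have h := congrArg (j ∈ ·) hst
    simp only [Finset.mem_cons, eq_iff_iff] at h
    by_cases hj : j = k
    · subst hj; exact iff_of_false (hk s) (hk t)
    · simpa [hj] using h
  · intro t ht
    simp [(Finset.mem_powersetCard.1 ht).2]
  · intro t _
    rw [Finset.prod_cons, Finset.prod_map]
    rfl
  · exact fun t _ => Finset.prod_nonneg fun j _ => hy j

lemma le_symPoly_one {r : ℕ} {y : Fin r → ℝ} (hy : ∀ j, 0 ≤ y j) (k : Fin r) :
    y k ≤ symPoly 1 r y := by
  have h : y k = ∏ i ∈ {k}, y i := by simp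
  rw [h]
  exact Finset.single_le_sum (f := fun t : Finset (Fin r) => ∏ i ∈ t, y i)
    (fun t _ => Finset.prod_nonneg fun j _ => hy j) (by simp)

/-- The continuous region has finite volume for `ℓ < r`. -/
lemma volume_continuousRegion_lt_top {ℓ : ℕ} (hℓ : 1 ≤ ℓ) :
    ∀ {r : ℕ}, ℓ < r → volume (continuousRegion ℓ r 1) < ⊤ := by
  induction ℓ, hℓ using Nat.le_induction with
  | base =>
    intro r _
    refine (measure_mono (t := Set.Icc 0 1) fun y hy => ⟨hy.1, fun k => ?_⟩).trans_lt
      isCompact_Icc.measure_lt_top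
    exact (le_symPoly_one hy.1 k).trans hy.2
  | succ ℓ hℓ ih =>
    intro r hr
    obtain ⟨r, rfl⟩ : ∃ s, r = s + 1 := ⟨r - 1, by omega⟩
    have hV := ih (r := r) (by omega)
    -- Outside the unit cube some coordinate `t` exceeds 1. The others then lie in the region with
    -- bound `1 / t`, of volume `t ^ (-r / ℓ)` times a constant by homogeneity. This is integrable
    -- at infinity because `ℓ < r`.
    set A : Set (ℝ × (Fin r → ℝ)) :=
      {p | 1 < p.1 ∧ (∀ k, 0 ≤ p.2 k) ∧ p.1 * symPoly ℓ r p.2 ≤ 1} with hA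
    have hAm : MeasurableSet A := by
      have : A = {p | 1 < p.1} ∩ ((⋂ k, {p | 0 ≤ p.2 k}) ∩ {p | p.1 * symPoly ℓ r p.2 ≤ 1}) := by
        ext p; simp [hA]
      rw [this]
      refine (measurableSet_lt measurable_const measurable_fst).inter
        ((MeasurableSet.iInter fun k => measurableSet_le measurable_const (by fun_prop)).inter
          (measurableSet_le (measurable_fst.mul
            ((continuous_symPoly ℓ r).measurable.comp measurable_snd)) measurable_const))
    have hAv : volume A < ⊤ := by
      rw [Measure.volume_eq_prod, Measure.prod_apply hAm]
      have hb : ∀ t : ℝ, volume (Prod.mk t ⁻¹' A) ≤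
          (Set.Ioi 1).indicator (fun t => ENNReal.ofReal (t ^ (-((r : ℝ) / ℓ))) *
            volume (continuousRegion ℓ r 1)) t := by
        intro t
        by_cases ht : 1 < t
        · have ht0 : 0 < t := by linarith
          rw [Set.indicator_of_mem (Set.mem_Ioi.2 ht), Real.rpow_neg ht0.le,
            ← Real.inv_rpow ht0.le, ← volume_continuousRegion hℓ (inv_pos.2 ht0)]
          refine measure_mono fun y hy => ⟨hy.2.1, ?_⟩
          rw [← one_div, le_div_iff₀ ht0, mul_comm]
          exact hy.2.2
        · have : Prod.mk t ⁻¹' A = ∅ := by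
            ext y
            simp [hA, ht]
          simp [this]
      refine (lintegral_mono hb).trans_lt ?_
      rw [lintegral_indicator measurableSet_Ioi, lintegral_mul_const' _ _ hV.ne]
      refine ENNReal.mul_lt_top ?_ hV
      have hlt : -((r : ℝ) / ℓ) < -1 := by
        have : (1 : ℝ) < (r : ℝ) / ℓ := by
          rw [one_lt_div (by exact_mod_cast hℓ)]
          exact_mod_cast (by omega : ℓ < r)
        linarith
      have hint := integrableOn_Ioi_rpow_of_lt hlt one_pos
      exact hint.lintegral_lt_top
    have hsub : continuousRegion (ℓ + 1) (r + 1) 1 ⊆ Set.Icc 0 1 ∪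
        ⋃ k, (MeasurableEquiv.piFinSuccAbove (fun _ => ℝ) k) ⁻¹' A := by
      intro y hy
      by_cases h : ∀ k, y k ≤ 1
      · exact Or.inl ⟨hy.1, h⟩
      · push Not at h
        obtain ⟨k, hk⟩ := h
        refine Or.inr (Set.mem_iUnion.2 ⟨k, hk, fun j => hy.1 _, ?_⟩)
        exact (mul_symPoly_succAbove_le ℓ r k hy.1).trans hy.2
    refine (measure_mono hsub).trans_lt ((measure_union_le _ _).trans_lt
      (ENNReal.add_lt_top.2 ⟨isCompact_Icc.measure_lt_top, ?_⟩))
    refine (measure_iUnion_le _).trans_lt ?_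
    rw [tsum_fintype]
    refine ENNReal.sum_lt_top.2 fun k _ => ?_
    rw [(volume_preserving_piFinSuccAbove (fun _ => ℝ) k).measure_preimage hAm.nullMeasurableSet]
    exact hAv

lemma volume_continuousRegion_pos {ℓ r : ℕ} (hℓ : 1 ≤ ℓ) (hℓr : ℓ ≤ r) :
    0 < volume (continuousRegion ℓ r 1) := by
  have hC : (1 : ℝ) ≤ (r.choose ℓ : ℝ) := by exact_mod_cast Nat.choose_pos hℓr
  have hC0 : (0 : ℝ) < (r.choose ℓ : ℝ) := by linarith
  have hsub : Set.univ.pi (fun _ : Fin r => Set.Ioc (0 : ℝ) (r.choose ℓ : ℝ)⁻¹) ⊆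
      continuousRegion ℓ r 1 := by
    intro y hy
    have hy' := fun k => hy k (Set.mem_univ k)
    refine ⟨fun k => (hy' k).1.le, ?_⟩
    refine (symPoly_mono ℓ r (fun k => (hy' k).1.le) (fun k => (hy' k).2)).trans ?_
    have : symPoly ℓ r (fun _ => (r.choose ℓ : ℝ)⁻¹) =
        (r.choose ℓ : ℝ) * (r.choose ℓ : ℝ)⁻¹ ^ ℓ := by
      rw [symPoly, Finset.sum_congr rfl fun t ht => by
        rw [Finset.prod_const, (Finset.mem_powersetCard.1 ht).2]]
      simp
    rw [this]
    calc (r.choose ℓ : ℝ) * (r.choose ℓ : ℝ)⁻¹ ^ ℓ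
        ≤ (r.choose ℓ : ℝ) * (r.choose ℓ : ℝ)⁻¹ :=
          mul_le_mul_of_nonneg_left (pow_le_of_le_one (by positivity) (inv_le_one_of_one_le₀ hC)
            (by omega)) hC0.le
      _ = 1 := mul_inv_cancel₀ hC0.ne'
  refine lt_of_lt_of_le ?_ (measure_mono hsub)
  rw [Real.volume_pi_Ioc, pos_iff_ne_zero, Finset.prod_ne_zero_iff]
  intro k _
  rw [sub_zero]
  exact (ENNReal.ofReal_pos.2 (inv_pos.2 hC0)).ne'

/-- The level set lies in the difference of the regions with bounds 1 and `c` for every `0 < c < 1`.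
By homogeneity the volume of this difference tends to zero as `c` tends to 1, since the total volume
is finite. -/
lemma ae_symPoly_ne_one {ℓ r : ℕ} (hℓ : 1 ≤ ℓ) (hℓr : ℓ < r) :
    ∀ᵐ y : Fin r → ℝ, ¬ ((∀ k, 0 ≤ y k) ∧ symPoly ℓ r y = 1) := by
  have hV := volume_continuousRegion_lt_top hℓ hℓr
  rw [ae_iff]
  simp only [not_not]
  have hbound : ∀ c ∈ Set.Ioo (0 : ℝ) 1, volume {y : Fin r → ℝ | (∀ k, 0 ≤ y k) ∧
      symPoly ℓ r y = 1} ≤ volume (continuousRegion ℓ r 1) -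
        ENNReal.ofReal (c ^ ((r : ℝ) / ℓ)) * volume (continuousRegion ℓ r 1) := by
    intro c hc
    rw [← volume_continuousRegion hℓ hc.1]
    have hsub : continuousRegion ℓ r c ⊆ continuousRegion ℓ r 1 :=
      fun y hy => ⟨hy.1, hy.2.trans hc.2.le⟩
    rw [← measure_sdiff hsub (measurableSet_continuousRegion ℓ r c).nullMeasurableSet
      (ne_top_of_le_ne_top hV.ne (measure_mono hsub))]
    exact measure_mono fun y hy => ⟨⟨hy.1, hy.2.le⟩, fun h => by
      have := h.2
      have := hy.2
      linarith [hc.2]⟩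
  have hlim : Tendsto (fun c : ℝ => volume (continuousRegion ℓ r 1) -
      ENNReal.ofReal (c ^ ((r : ℝ) / ℓ)) * volume (continuousRegion ℓ r 1)) (𝓝[<] 1)
      (𝓝 (volume (continuousRegion ℓ r 1) -
        ENNReal.ofReal (1 ^ ((r : ℝ) / ℓ)) * volume (continuousRegion ℓ r 1))) := by
    refine ENNReal.Tendsto.sub tendsto_const_nhds ?_ (Or.inl hV.ne)
    refine ENNReal.Tendsto.mul_const ?_ (Or.inr hV.ne)
    refine ENNReal.tendsto_ofReal ?_
    exact ((Real.continuousAt_rpow_const 1 _ (Or.inl one_ne_zero)).tendsto).mono_left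
      nhdsWithin_le_nhds
  rw [Real.one_rpow, ENNReal.ofReal_one, one_mul, tsub_self] at hlim
  exact nonpos_iff_eq_zero.1 (ge_of_tendsto hlim
    (eventually_of_mem (Ioo_mem_nhdsLT one_pos) hbound))

lemma ae_forall_ne_zero (r : ℕ) : ∀ᵐ y : Fin r → ℝ, ∀ k, y k ≠ 0 :=
  ae_all_iff.2 fun k => Measure.ae_eval_ne _ k 0

/-! ### Riemann sums over the region for `ℓ < r` -/

/-- The scaling `n ^ (1 / ℓ)`. -/
noncomputable def scale (ℓ n : ℕ) : ℝ := (n : ℝ) ^ ((1 : ℝ) / ℓ)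

lemma scale_pos {ℓ n : ℕ} (hn : 1 ≤ n) : 0 < scale ℓ n :=
  Real.rpow_pos_of_pos (by exact_mod_cast hn) _

lemma scale_pow_self {ℓ : ℕ} (hℓ : 1 ≤ ℓ) (n : ℕ) : scale ℓ n ^ ℓ = n := by
  have hl0 : (ℓ : ℝ) ≠ 0 := by exact_mod_cast (by omega : ℓ ≠ 0)
  rw [scale, ← Real.rpow_natCast, ← Real.rpow_mul (Nat.cast_nonneg n), one_div_mul_cancel hl0,
    Real.rpow_one]

lemma scale_pow (ℓ n r : ℕ) : scale ℓ n ^ r = (n : ℝ) ^ ((r : ℝ) / ℓ) := by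
  rw [scale, ← Real.rpow_natCast, ← Real.rpow_mul (Nat.cast_nonneg n), one_div_mul_eq_div]

lemma tendsto_scale {ℓ : ℕ} (hℓ : 1 ≤ ℓ) : Tendsto (scale ℓ) atTop atTop :=
  (tendsto_rpow_atTop (by positivity)).comp tendsto_natCast_atTop_atTop

/-- The lattice point attached to a real point. -/
noncomputable def ceilPoint (c : ℝ) {r : ℕ} (z : Fin r → ℝ) (k : Fin r) : ℕ := ⌈z k * c⌉₊

/-- The half-open box attached to a lattice point. -/
def scaledBox (c : ℝ) {r : ℕ} (i : Fin r → ℕ) : Set (Fin r → ℝ) :=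
  Set.univ.pi fun k => Set.Ioc (((i k : ℝ) - 1) / c) ((i k : ℝ) / c)

lemma measurableSet_scaledBox (c : ℝ) {r : ℕ} (i : Fin r → ℕ) : MeasurableSet (scaledBox c i) :=
  MeasurableSet.univ_pi fun _ => measurableSet_Ioc

lemma volume_scaledBox {c : ℝ} (hc : 0 < c) {r : ℕ} (i : Fin r → ℕ) :
    volume (scaledBox c i) = ENNReal.ofReal ((c ^ r)⁻¹) := by
  rw [scaledBox, Real.volume_pi_Ioc]
  have : ∀ k, (i k : ℝ) / c - ((i k : ℝ) - 1) / c = c⁻¹ := fun k => by field_simp; ring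
  simp only [this]
  rw [Finset.prod_const, ← ENNReal.ofReal_pow (by positivity), inv_pow]
  simp

/-- Boxes open below and closed above match the ceiling. Positivity of `i` matters because the
natural ceiling sends all nonpositive reals to 0. -/
lemma mem_scaledBox_iff {c : ℝ} (hc : 0 < c) {r : ℕ} {i : Fin r → ℕ} (hi : ∀ k, 1 ≤ i k)
    (z : Fin r → ℝ) : z ∈ scaledBox c i ↔ ceilPoint c z = i := by
  simp only [scaledBox, Set.mem_univ_pi, Set.mem_Ioc, funext_iff, ceilPoint]
  refine forall_congr' fun k => ?_
  rw [Nat.ceil_eq_iff (by have := hi k; omega), div_lt_iff₀ hc, le_div_iff₀ hc, Nat.cast_sub (hi k),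
    Nat.cast_one]

lemma pos_of_mem_scaledBox {c : ℝ} (hc : 0 < c) {r : ℕ} {i : Fin r → ℕ} (hi : ∀ k, 1 ≤ i k)
    {z : Fin r → ℝ} (hz : z ∈ scaledBox c i) (k : Fin r) : 0 < z k := by
  have h1 : (1 : ℝ) ≤ i k := by exact_mod_cast hi k
  exact lt_of_le_of_lt (div_nonneg (by linarith) hc.le) (hz k (Set.mem_univ k)).1

/-- The step function on real points whose integral is a normalized sum over lattice points. -/
noncomputable def stepFun (c : ℝ) {r : ℕ} (D : Finset (Fin r → ℕ)) (g : (Fin r → ℕ) → ℝ)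
    (z : Fin r → ℝ) : ℝ :=
  ∑ i ∈ D, (scaledBox c i).indicator (fun _ => g i) z

lemma measurable_stepFun (c : ℝ) {r : ℕ} (D : Finset (Fin r → ℕ)) (g : (Fin r → ℕ) → ℝ) :
    Measurable (stepFun c D g) :=
  Finset.measurable_fun_sum _ fun i _ => measurable_const.indicator (measurableSet_scaledBox c i)

lemma integral_stepFun {c : ℝ} (hc : 0 < c) {r : ℕ} (D : Finset (Fin r → ℕ))
    (g : (Fin r → ℕ) → ℝ) : ∫ z, stepFun c D g z = (∑ i ∈ D, g i) / c ^ r := by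
  simp only [stepFun]
  rw [integral_finsetSum, Finset.sum_div]
  · refine Finset.sum_congr rfl fun i _ => ?_
    rw [integral_indicator_const _ (measurableSet_scaledBox c i), Measure.real,
      volume_scaledBox hc, ENNReal.toReal_ofReal (by positivity), smul_eq_mul, div_eq_inv_mul]
  · intro i _
    rw [integrable_indicator_iff (measurableSet_scaledBox c i)]
    exact integrableOn_const (by rw [volume_scaledBox hc]; exact ENNReal.ofReal_ne_top)

open Classical in
lemma stepFun_eq {c : ℝ} (hc : 0 < c) {r : ℕ} {D : Finset (Fin r → ℕ)} (hD : IsDownRegion D)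
    (g : (Fin r → ℕ) → ℝ) (z : Fin r → ℝ) :
    stepFun c D g z = if ceilPoint c z ∈ D then g (ceilPoint c z) else 0 := by
  rw [stepFun, ← Finset.sum_ite_eq D (ceilPoint c z) g]
  refine Finset.sum_congr rfl fun i hi => ?_
  rw [Set.indicator_apply]
  exact if_congr (mem_scaledBox_iff hc (hD.pos i hi) z) rfl rfl

/-- The ceiling rounds up, so `z` lies below a point of the scaled region. Hence the indicator of
the continuous region dominates all step functions, without boundary terms. -/
lemma mem_continuousRegion_of_ceilPoint_mem {ℓ r : ℕ} (hℓ : 1 ≤ ℓ) (hℓr : ℓ ≤ r) {n : ℕ}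
    (hn : 1 ≤ n) {z : Fin r → ℝ} (hz : ceilPoint (scale ℓ n) z ∈ region hℓ hℓr n) :
    (∀ k, 0 < z k) ∧ z ∈ continuousRegion ℓ r 1 := by
  have hc := scale_pos (ℓ := ℓ) hn
  have hm := (mem_region hℓ hℓr).1 hz
  have hpos := pos_of_mem_scaledBox hc hm.1 ((mem_scaledBox_iff hc hm.1 z).2 rfl)
  refine ⟨hpos, fun k => (hpos k).le, ?_⟩
  have h1 : symPoly ℓ r (fun k => scale ℓ n * z k) ≤ n := by
    refine (symPoly_mono ℓ r (fun k => (mul_pos hc (hpos k)).le) fun k => ?_).trans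
      (by rw [← symPoly_cast]; exact_mod_cast hm.2 :
        symPoly ℓ r (fun k => (ceilPoint (scale ℓ n) z k : ℝ)) ≤ n)
    rw [mul_comm]
    exact Nat.le_ceil _
  rw [symPoly_smul, scale_pow_self hℓ] at h1
  have hn0 : (0 : ℝ) < n := by exact_mod_cast hn
  exact le_of_mul_le_mul_left (by linarith) hn0

lemma tendsto_ceilPoint_div {ℓ r : ℕ} (hℓ : 1 ≤ ℓ) {z : Fin r → ℝ} (hz : ∀ k, 0 < z k)
    (k : Fin r) :
    Tendsto (fun n => (ceilPoint (scale ℓ n) z k : ℝ) / scale ℓ n) atTop (𝓝 (z k)) :=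
  (tendsto_nat_ceil_mul_div_atTop (hz k).le).comp (tendsto_scale hℓ)

lemma eventually_ceilPoint_mem {ℓ r : ℕ} (hℓ : 1 ≤ ℓ) (hℓr : ℓ ≤ r) {z : Fin r → ℝ}
    (hz : ∀ k, 0 < z k) (hP : symPoly ℓ r z < 1) :
    ∀ᶠ n in atTop, ceilPoint (scale ℓ n) z ∈ region hℓ hℓr n := by
  have h1 : Tendsto (fun n => symPoly ℓ r fun k => (ceilPoint (scale ℓ n) z k : ℝ) / scale ℓ n)
      atTop (𝓝 (symPoly ℓ r z)) :=
    ((continuous_symPoly ℓ r).tendsto z).comp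
      (tendsto_pi_nhds.2 fun k => tendsto_ceilPoint_div hℓ hz k)
  filter_upwards [h1.eventually_lt_const hP, eventually_ge_atTop 1] with n hn hn1
  have hc := scale_pos (ℓ := ℓ) hn1
  refine (mem_region hℓ hℓr).2 ⟨fun k => Nat.ceil_pos.2 (mul_pos (hz k) hc), ?_⟩
  have e : symPoly ℓ r (fun k => (ceilPoint (scale ℓ n) z k : ℝ)) =
      n * symPoly ℓ r fun k => (ceilPoint (scale ℓ n) z k : ℝ) / scale ℓ n := by
    rw [← scale_pow_self hℓ n, ← symPoly_smul]
    congr 1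
    funext k
    rw [mul_div_cancel₀ _ hc.ne']
  have hn0 : (0 : ℝ) < n := by exact_mod_cast hn1
  have : ((symPoly ℓ r (ceilPoint (scale ℓ n) z) : ℕ) : ℝ) ≤ n := by
    rw [symPoly_cast, e]
    nlinarith
  exact_mod_cast this

/-- Convergence of normalized sums over the discrete region to integrals over the continuous
region. -/
lemma tendsto_sum_region {ℓ r : ℕ} (hℓ : 1 ≤ ℓ) (hℓr : ℓ < r) (g : ℕ → (Fin r → ℕ) → ℝ)
    (hg : ∀ n, ∀ i ∈ region hℓ hℓr.le n, |g n i| ≤ 1) (G : (Fin r → ℝ) → ℝ)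
    (hG : ∀ z : Fin r → ℝ, (∀ k, 0 < z k) →
      Tendsto (fun n => g n (ceilPoint (scale ℓ n) z)) atTop (𝓝 (G z))) :
    Tendsto (fun n => (∑ i ∈ region hℓ hℓr.le n, g n i) / scale ℓ n ^ r) atTop
      (𝓝 (∫ z in continuousRegion ℓ r 1, G z)) := by
  classical
  rw [← integral_indicator (measurableSet_continuousRegion ℓ r 1)]
  have key : Tendsto (fun n => ∫ z, stepFun (scale ℓ n) (region hℓ hℓr.le n) (g n) z) atTop
      (𝓝 (∫ z, (continuousRegion ℓ r 1).indicator G z)) := by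
    refine tendsto_integral_filter_of_dominated_convergence
      ((continuousRegion ℓ r 1).indicator fun _ => 1)
      (Eventually.of_forall fun n => (measurable_stepFun _ _ _).aestronglyMeasurable) ?_ ?_ ?_
    · filter_upwards [eventually_ge_atTop 1] with n hn
      refine Eventually.of_forall fun z => ?_
      rw [stepFun_eq (scale_pos hn) (isDownRegion_region hℓ hℓr.le n)]
      split_ifs with h
      · rw [Set.indicator_of_mem (mem_continuousRegion_of_ceilPoint_mem hℓ hℓr.le hn h).2]
        exact hg n _ h
      · rw [norm_zero]
        exact Set.indicator_nonneg (fun _ _ => zero_le_one) _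
    · rw [integrable_indicator_iff (measurableSet_continuousRegion ℓ r 1)]
      exact integrableOn_const (volume_continuousRegion_lt_top hℓ hℓr).ne
    -- Off the level set and the coordinate hyperplanes, every point is either a positive interior
    -- point or outside the region, where the step functions vanish.
    · filter_upwards [ae_symPoly_ne_one hℓ hℓr, ae_forall_ne_zero r] with z hz1 hz0
      by_cases hz : ∀ k, 0 ≤ z k
      · have hpos : ∀ k, 0 < z k := fun k => lt_of_le_of_ne (hz k) (hz0 k).symm
        rcases lt_or_ge (symPoly ℓ r z) 1 with hP | hP
        · rw [Set.indicator_of_mem (show z ∈ continuousRegion ℓ r 1 from ⟨hz, hP.le⟩)]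
          refine (hG z hpos).congr' ?_
          filter_upwards [eventually_ge_atTop 1, eventually_ceilPoint_mem hℓ hℓr.le hpos hP]
            with n hn hmem
          rw [stepFun_eq (scale_pos hn) (isDownRegion_region hℓ hℓr.le n), if_pos hmem]
        · have hnot : z ∉ continuousRegion ℓ r 1 := fun h => hz1 ⟨hz, le_antisymm h.2 hP⟩
          rw [Set.indicator_of_notMem hnot]
          refine tendsto_const_nhds.congr' ?_
          filter_upwards [eventually_ge_atTop 1] with n hn
          rw [stepFun_eq (scale_pos hn) (isDownRegion_region hℓ hℓr.le n), if_neg]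
          exact fun h => hnot (mem_continuousRegion_of_ceilPoint_mem hℓ hℓr.le hn h).2
      · have hnot : z ∉ continuousRegion ℓ r 1 := fun h => hz h.1
        rw [Set.indicator_of_notMem hnot]
        refine tendsto_const_nhds.congr' ?_
        filter_upwards [eventually_ge_atTop 1] with n hn
        rw [stepFun_eq (scale_pos hn) (isDownRegion_region hℓ hℓr.le n), if_neg]
        exact fun h => hnot (mem_continuousRegion_of_ceilPoint_mem hℓ hℓr.le hn h).2
  refine key.congr' ?_
  filter_upwards [eventually_ge_atTop 1] with n hn
  exact integral_stepFun (scale_pos hn) _ _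

/-- The same limit with `g = 1` gives the asymptotic number of points, and the scaling cancels in
the quotient. -/
lemma tendsto_avg_region {ℓ r : ℕ} (hℓ : 1 ≤ ℓ) (hℓr : ℓ < r) (g : ℕ → (Fin r → ℕ) → ℝ)
    (hg : ∀ n, ∀ i ∈ region hℓ hℓr.le n, |g n i| ≤ 1) (G : (Fin r → ℝ) → ℝ)
    (hG : ∀ z : Fin r → ℝ, (∀ k, 0 < z k) →
      Tendsto (fun n => g n (ceilPoint (scale ℓ n) z)) atTop (𝓝 (G z))) :
    Tendsto (fun n => avg (region hℓ hℓr.le n) (g n)) atTop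
      (𝓝 ((∫ z in continuousRegion ℓ r 1, G z) / volume.real (continuousRegion ℓ r 1))) := by
  have h1 := tendsto_sum_region hℓ hℓr g hg G hG
  have h2 := tendsto_sum_region hℓ hℓr (fun _ _ => 1) (by simp) (fun _ => 1)
    fun _ _ => tendsto_const_nhds
  simp only [Finset.sum_const, nsmul_eq_mul, mul_one, integral_const, smul_eq_mul,
    measureReal_restrict_apply_univ] at h2
  have hV : volume.real (continuousRegion ℓ r 1) ≠ 0 :=
    (ENNReal.toReal_pos (volume_continuousRegion_pos hℓ hℓr.le).ne'
      (volume_continuousRegion_lt_top hℓ hℓr).ne).ne'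
  refine (h1.div h2 hV).congr' ?_
  filter_upwards [eventually_ge_atTop 1] with n hn
  exact div_div_div_cancel_right₀ (pow_pos (scale_pos hn) r).ne' _ _

lemma isAdmissible_region_lt {ℓ r : ℕ} (hℓ : 1 ≤ ℓ) (hℓr : ℓ < r) :
    IsAdmissible (region hℓ hℓr.le) (fun n => scaledProduct (r := r) ℓ n) fun a =>
      (∫ z in continuousRegion ℓ r 1, (∏ k, z k) ^ a) / volume.real (continuousRegion ℓ r 1) := by
  classical
  refine isAdmissible_region hℓ hℓr.le (fun k => ?_) fun a => ?_
  -- A fixed positive point eventually has `k`-th ceiling greater than 1, so the indicator of the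
  -- face tends to zero pointwise.
  · have h := tendsto_avg_region hℓ hℓr (fun _ i => if i k = 1 then 1 else 0)
      (fun n i _ => by split_ifs <;> simp) (fun _ => 0) fun z hz => by
        refine tendsto_const_nhds.congr' ?_
        filter_upwards [(tendsto_scale hℓ).eventually_gt_atTop (1 / z k)] with n hn
        rw [div_lt_iff₀' (hz k)] at hn
        have : 1 < ceilPoint (scale ℓ n) z k := Nat.lt_ceil.2 (by exact_mod_cast hn)
        rw [if_neg this.ne']
    simp only [integral_zero, zero_div] at h
    refine h.congr fun n => ?_
    rw [avg, Finset.sum_boole, faceRatio]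
  · refine tendsto_avg_region hℓ hℓr _ (fun n i hi => ?_) _ fun z hz => ?_
    · rw [abs_of_nonneg (pow_nonneg (scaledProduct_nonneg ℓ n i) a)]
      exact pow_le_one₀ (scaledProduct_nonneg ℓ n i) (scaledProduct_le_one hℓ hℓr.le hi)
    · refine Tendsto.pow ?_ a
      have e : ∀ n, scaledProduct ℓ n (ceilPoint (scale ℓ n) z) =
          ∏ k, (ceilPoint (scale ℓ n) z k : ℝ) / scale ℓ n := by
        intro n
        rw [scaledProduct, Finset.prod_div_distrib, Finset.prod_const, Finset.card_univ,
          Fintype.card_fin, scale_pow]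
      simp only [e]
      exact tendsto_finsetProd _ fun k _ => tendsto_ceilPoint_div hℓ hz k

/-! ### From moments to continuous test functions on `[0, 1]` -/

lemma integrable_comp_of_mem_Icc {Ω : Type*} [MeasurableSpace Ω] {P : Measure Ω}
    [IsFiniteMeasure P] {Z : Ω → ℝ} (hZm : Measurable Z) (hZ : ∀ᵐ ω ∂P, Z ω ∈ Set.Icc (0 : ℝ) 1)
    {φ : ℝ → ℝ} (hφ : Continuous φ) : Integrable (fun ω => φ (Z ω)) P := by
  obtain ⟨C, hC⟩ := (isCompact_Icc (a := (0 : ℝ)) (b := 1)).exists_bound_of_continuousOn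
    hφ.continuousOn
  exact Integrable.of_bound (hφ.measurable.comp hZm).aestronglyMeasurable C
    (hZ.mono fun ω hω => hC _ hω)

lemma dist_integral_comp_le {Ω : Type*} [MeasurableSpace Ω] {P : Measure Ω}
    [IsProbabilityMeasure P] {Z : Ω → ℝ} (hZm : Measurable Z)
    (hZ : ∀ᵐ ω ∂P, Z ω ∈ Set.Icc (0 : ℝ) 1) {φ ψ : ℝ → ℝ} (hφ : Continuous φ) (hψ : Continuous ψ)
    {ε : ℝ} (h : ∀ x ∈ Set.Icc (0 : ℝ) 1, |φ x - ψ x| ≤ ε) :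
    dist (∫ ω, φ (Z ω) ∂P) (∫ ω, ψ (Z ω) ∂P) ≤ ε := by
  rw [dist_eq_norm, ← integral_sub (integrable_comp_of_mem_Icc hZm hZ hφ)
    (integrable_comp_of_mem_Icc hZm hZ hψ)]
  refine (norm_integral_le_of_norm_le_const (C := ε) (hZ.mono fun ω hω => h _ hω)).trans_eq ?_
  simp

lemma integral_eval_comp {Ω : Type*} [MeasurableSpace Ω] {P : Measure Ω}
    [IsFiniteMeasure P] {Z : Ω → ℝ} (hZm : Measurable Z) (hZ : ∀ᵐ ω ∂P, Z ω ∈ Set.Icc (0 : ℝ) 1)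
    (p : Polynomial ℝ) : ∫ ω, p.eval (Z ω) ∂P =
      ∑ a ∈ Finset.range (p.natDegree + 1), p.coeff a * ∫ ω, Z ω ^ a ∂P := by
  simp only [Polynomial.eval_eq_sum_range]
  rw [integral_finsetSum]
  · simp only [integral_const_mul]
  · intro a _
    exact (integrable_comp_of_mem_Icc hZm hZ (continuous_pow a)).const_mul _

section Moments

variable {Ω : ℕ → Type*} [∀ n, MeasurableSpace (Ω n)]
  {P : (n : ℕ) → Measure (Ω n)} [∀ n, IsProbabilityMeasure (P n)]
  {Ω' : Type*} [MeasurableSpace Ω'] {μ : Measure Ω'} [IsProbabilityMeasure μ]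
  {Z : (n : ℕ) → Ω n → ℝ} {Y : Ω' → ℝ}

/-- For random variables with values in `[0, 1]`, convergence of moments implies convergence of the
expectations of continuous functions. -/
lemma tendsto_integral_of_tendsto_moments (hZm : ∀ n, Measurable (Z n)) (hYm : Measurable Y)
    (hZ : ∀ᶠ n in atTop, ∀ᵐ ω ∂(P n), Z n ω ∈ Set.Icc (0 : ℝ) 1)
    (hY : ∀ᵐ ω ∂μ, Y ω ∈ Set.Icc (0 : ℝ) 1)
    (hmom : ∀ a : ℕ, Tendsto (fun n => ∫ ω, Z n ω ^ a ∂(P n)) atTop (𝓝 (∫ ω, Y ω ^ a ∂μ)))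
    {φ : ℝ → ℝ} (hφ : Continuous φ) :
    Tendsto (fun n => ∫ ω, φ (Z n ω) ∂(P n)) atTop (𝓝 (∫ ω, φ (Y ω) ∂μ)) := by
  rw [Metric.tendsto_nhds]
  intro ε hε
  -- Weierstrass approximation: the expectation of `p` is a finite combination of moments, and the
  -- replacement costs at most `ε / 3` on each side.
  obtain ⟨p, hp⟩ := exists_polynomial_near_of_continuousOn 0 1 φ hφ.continuousOn (ε / 3)
    (by positivity)
  have hp' : ∀ x ∈ Set.Icc (0 : ℝ) 1, |φ x - p.eval x| ≤ ε / 3 := fun x hx => by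
    rw [abs_sub_comm]; exact (hp x hx).le
  have hlim : Tendsto (fun n => ∑ a ∈ Finset.range (p.natDegree + 1),
      p.coeff a * ∫ ω, Z n ω ^ a ∂(P n)) atTop (𝓝 (∫ ω, p.eval (Y ω) ∂μ)) := by
    rw [integral_eval_comp hYm hY]
    exact tendsto_finsetSum _ fun a _ => (hmom a).const_mul _
  filter_upwards [hZ, Metric.tendsto_nhds.1 hlim (ε / 3) (by positivity)] with n hn hd
  rw [← integral_eval_comp (hZm n) hn] at hd
  have d1 := dist_integral_comp_le (hZm n) hn hφ p.continuous hp'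
  have d2 := dist_integral_comp_le hYm hY hφ p.continuous hp'
  have t1 := dist_triangle (∫ ω, φ (Z n ω) ∂(P n)) (∫ ω, p.eval (Z n ω) ∂(P n)) (∫ ω, φ (Y ω) ∂μ)
  have t2 := dist_triangle_right (∫ ω, p.eval (Z n ω) ∂(P n)) (∫ ω, φ (Y ω) ∂μ)
    (∫ ω, p.eval (Y ω) ∂μ)
  linarith

lemma tendstoInDistribution_of_tendsto_moments (hZm : ∀ n, Measurable (Z n)) (hYm : Measurable Y)
    (hZ : ∀ᶠ n in atTop, ∀ᵐ ω ∂(P n), Z n ω ∈ Set.Icc (0 : ℝ) 1)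
    (hY : ∀ᵐ ω ∂μ, Y ω ∈ Set.Icc (0 : ℝ) 1)
    (hmom : ∀ a : ℕ, Tendsto (fun n => ∫ ω, Z n ω ^ a ∂(P n)) atTop (𝓝 (∫ ω, Y ω ^ a ∂μ))) :
    TendstoInDistribution Z atTop Y P μ where
  forall_aemeasurable n := (hZm n).aemeasurable
  aemeasurable_limit := hYm.aemeasurable
  tendsto := by
    refine ProbabilityMeasure.tendsto_iff_forall_integral_tendsto.2 fun f => ?_
    have h := tendsto_integral_of_tendsto_moments hZm hYm hZ hY hmom f.continuous
    change Tendsto (fun n => ∫ x, f x ∂((P n).map (Z n))) atTop (𝓝 (∫ x, f x ∂(μ.map Y)))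
    rw [integral_map hYm.aemeasurable f.continuous.aestronglyMeasurable]
    refine h.congr fun n => ?_
    rw [integral_map (hZm n).aemeasurable f.continuous.aestronglyMeasurable]

end Moments

/-! ### Uniform vectors and averages -/

section Uniform

variable {r ℓ : ℕ} {Ω : Type*} [MeasurableSpace Ω] {P : Measure Ω} [IsProbabilityMeasure P]
  {V : Ω → Fin r → ℕ}

lemma ae_mem_of_uniform {D : Finset (Fin r → ℕ)} (hD : D.Nonempty) (hV : Measurable V)
    (hunif : ∀ i ∈ D, P.real {ω | V ω = i} = 1 / (D.card : ℝ)) : ∀ᵐ ω ∂P, V ω ∈ D := by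
  have hset : V ⁻¹' (D : Set (Fin r → ℕ)) = ⋃ i ∈ D, {ω | V ω = i} := by
    ext ω; simp
  have hm : ∀ i, MeasurableSet {ω | V ω = i} := fun i => hV (measurableSet_singleton i)
  have hc : (D.card : ℝ) ≠ 0 := by exact_mod_cast hD.card_pos.ne'
  have h1 : P.real (V ⁻¹' (D : Set (Fin r → ℕ))) = 1 := by
    rw [hset, measureReal_biUnion_finset _ fun i _ => hm i, Finset.sum_congr rfl hunif,
      Finset.sum_const, nsmul_eq_mul, mul_one_div_cancel hc]
    intro i _ j _ hij
    refine Set.disjoint_left.2 fun ω hi hj => hij ?_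
    exact (show V ω = i from hi).symm.trans hj
  have h2 : P (V ⁻¹' (D : Set (Fin r → ℕ))) = 1 := by
    rw [← ENNReal.ofReal_one, ← h1, ofReal_measureReal]
  exact (mem_ae_iff_prob_eq_one (hV D.measurableSet)).2 h2

lemma integral_eq_avg_of_uniform {D : Finset (Fin r → ℕ)} (hD : D.Nonempty) (hV : Measurable V)
    (hunif : ∀ i ∈ D, P.real {ω | V ω = i} = 1 / (D.card : ℝ)) (g : (Fin r → ℕ) → ℝ) :
    ∫ ω, g (V ω) ∂P = avg D g := by
  have hg : Measurable g := measurable_of_countable g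
  rw [← integral_map hV.aemeasurable hg.aestronglyMeasurable]
  have hae : ∀ᵐ i ∂(P.map V), i ∈ (D : Set (Fin r → ℕ)) :=
    (ae_map_iff hV.aemeasurable D.measurableSet).2 (ae_mem_of_uniform hD hV hunif)
  have hfin : IsFiniteMeasure (P.map V) := Measure.isFiniteMeasure_map P V
  rw [← Measure.restrict_eq_self_of_ae_mem hae, setIntegral_finset]
  · rw [avg, Finset.sum_div]
    refine Finset.sum_congr rfl fun i hi => ?_
    rw [map_measureReal_apply hV (measurableSet_singleton i), smul_eq_mul, div_eq_inv_mul,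
      ← one_div, ← hunif i hi]
    rfl
  · exact IntegrableOn.finset

lemma card_region_eq (hℓ : 1 ≤ ℓ) (hℓr : ℓ ≤ r) (n : ℕ) :
    (region hℓ hℓr n).card = (discreteRegion ℓ r n).ncard :=
  (Set.ncard_eq_toFinset_card _ _).symm

end Uniform

/-- This factorization reduces the second convergence to joint moments with equal exponents. -/
lemma lcmOverPower_eq (ℓ n : ℕ) {r : ℕ} {v : Fin r → ℕ} (hv : ∀ k, 1 ≤ v k) :
    lcmOverPower ℓ n v = scaledProduct ℓ n v * lcmOverProduct v := by
  have h : ∏ k, (v k : ℝ) ≠ 0 := Finset.prod_ne_zero_iff.2 fun k _ => by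
    exact_mod_cast Nat.one_le_iff_ne_zero.1 (hv k)
  rw [lcmOverPower, scaledProduct, lcmOverProduct]
  field_simp

/-! ### The law of `U` -/

section LimitLaw

variable {r ℓ : ℕ} {Ω' : Type*} [MeasurableSpace Ω'] {μ : Measure Ω'}
  {U : Ω' → ℝ}

lemma integral_pow_of_isUniform (hU : Measurable U)
    (h : pdf.IsUniform U (Set.Icc (0 : ℝ) 1) μ volume) (a : ℕ) :
    ∫ ω, U ω ^ a ∂μ = 1 / ((a : ℝ) + 1) := by
  have h' : μ.map U = volume.restrict (Set.Icc (0 : ℝ) 1) := by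
    rw [show μ.map U = ProbabilityTheory.cond volume (Set.Icc (0 : ℝ) 1) from h,
      ProbabilityTheory.cond]
    simp
  rw [← integral_map (f := fun x : ℝ => x ^ a) hU.aemeasurable
    (continuous_pow a).aestronglyMeasurable, h', integral_Icc_eq_integral_Ioc,
    ← intervalIntegral.integral_of_le zero_le_one, integral_pow]
  simp

lemma ae_mem_Icc_of_isUniform (hU : Measurable U)
    (h : pdf.IsUniform U (Set.Icc (0 : ℝ) 1) μ volume) : ∀ᵐ ω ∂μ, U ω ∈ Set.Icc (0 : ℝ) 1 := by
  have h' : μ.map U = volume.restrict (Set.Icc (0 : ℝ) 1) := by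
    rw [show μ.map U = ProbabilityTheory.cond volume (Set.Icc (0 : ℝ) 1) from h,
      ProbabilityTheory.cond]
    simp
  refine (ae_map_iff hU.aemeasurable measurableSet_Icc).1 ?_
  rw [h']
  exact ae_restrict_mem measurableSet_Icc

/-- The law of `U` is that of the product of the coordinates of a uniform point of the continuous
region. -/
lemma map_eq_of_productCDF [IsProbabilityMeasure μ] (hℓ : 1 ≤ ℓ) (hℓr : ℓ < r)
    (hU : Measurable U)
    (h : ∀ x ∈ Set.Icc (0 : ℝ) ((r.choose ℓ : ℝ) ^ (-((r : ℝ) / (ℓ : ℝ)))),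
      μ.real {ω | U ω ≤ x} = productCDF ℓ r x) :
    μ.map U = (ProbabilityTheory.cond volume (continuousRegion ℓ r 1)).map fun z => ∏ k, z k := by
  have hV0 := (volume_continuousRegion_pos hℓ hℓr.le).ne'
  have hVt := (volume_continuousRegion_lt_top hℓ hℓr).ne
  have hprob : IsProbabilityMeasure (ProbabilityTheory.cond volume (continuousRegion ℓ r 1)) :=
    cond_isProbabilityMeasure_of_finite hV0 hVt
  have hpm : Measurable fun z : Fin r → ℝ => ∏ k, z k := by fun_prop
  have hfin : IsFiniteMeasure (μ.map U) := Measure.isFiniteMeasure_map μ U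
  have hfin' : IsProbabilityMeasure
      ((ProbabilityTheory.cond volume (continuousRegion ℓ r 1)).map fun z => ∏ k, z k) :=
    Measure.isProbabilityMeasure_map hpm.aemeasurable
  have hcdf : ∀ x, ((ProbabilityTheory.cond volume (continuousRegion ℓ r 1)).map
      fun z => ∏ k, z k).real (Set.Iic x) = productCDF ℓ r x := by
    intro x
    rw [map_measureReal_apply hpm measurableSet_Iic, Measure.real, cond_apply
      (measurableSet_continuousRegion ℓ r 1), ENNReal.toReal_mul, ENNReal.toReal_inv, productCDF,
      div_eq_inv_mul]
    rfl
  have hb : (0 : ℝ) ≤ (r.choose ℓ : ℝ) ^ (-((r : ℝ) / (ℓ : ℝ))) :=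
    Real.rpow_nonneg (Nat.cast_nonneg _) _
  have hUreal : ∀ x, (μ.map U).real (Set.Iic x) = μ.real {ω | U ω ≤ x} := fun x =>
    map_measureReal_apply hU measurableSet_Iic
  have hzero : ∀ x ≤ 0, productCDF ℓ r x = 0 := by
    intro x hx
    have : volume {y : Fin r → ℝ | y ∈ continuousRegion ℓ r 1 ∧ ∏ k, y k ≤ x} = 0 := by
      refine measure_mono_null (fun y hy => ?_) (ae_iff.1 (ae_forall_ne_zero r))
      have h0 : ∏ k, y k = 0 :=
        le_antisymm (hy.2.trans hx) (Finset.prod_nonneg fun k _ => hy.1.1 k)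
      obtain ⟨k, -, hk⟩ := Finset.prod_eq_zero_iff.1 h0
      exact fun hall => hall k hk
    rw [productCDF, Measure.real, this, ENNReal.toReal_zero, zero_div]
  have hone : ∀ x, (r.choose ℓ : ℝ) ^ (-((r : ℝ) / (ℓ : ℝ))) ≤ x → productCDF ℓ r x = 1 := by
    intro x hx
    have : {y : Fin r → ℝ | y ∈ continuousRegion ℓ r 1 ∧ ∏ k, y k ≤ x} =
        continuousRegion ℓ r 1 := by
      refine Set.Subset.antisymm (fun y hy => hy.1) fun y hy => ⟨hy, ?_⟩
      refine (prod_le_rpow hℓ hℓr.le hy.1 hy.2).trans (le_trans (le_of_eq ?_) hx)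
      rw [one_div, Real.inv_rpow (Nat.cast_nonneg _), Real.rpow_neg (Nat.cast_nonneg _)]
    rw [productCDF, this]
    exact div_self (ENNReal.toReal_pos hV0 hVt).ne'
  refine Measure.ext_of_Iic _ _ fun x => ?_
  rw [← measureReal_eq_measureReal_iff, hcdf, hUreal]
  -- The distribution function is prescribed only on an interval, but it equals 0 and 1 at the
  -- endpoints, so monotonicity determines it elsewhere.
  rcases lt_or_ge x 0 with hx | hx
  · rw [hzero x hx.le]
    refine le_antisymm ?_ measureReal_nonneg
    rw [← hzero 0 le_rfl, ← h 0 ⟨le_rfl, hb⟩]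
    exact measureReal_mono fun ω (hω : U ω ≤ x) => hω.trans hx.le
  · rcases le_or_gt x ((r.choose ℓ : ℝ) ^ (-((r : ℝ) / (ℓ : ℝ)))) with hx' | hx'
    · exact h x ⟨hx, hx'⟩
    · rw [hone x hx'.le]
      refine le_antisymm measureReal_le_one ?_
      rw [← hone _ le_rfl, ← h _ ⟨hb, le_rfl⟩]
      exact measureReal_mono fun ω hω => le_trans hω hx'.le

lemma integral_pow_of_productCDF [IsProbabilityMeasure μ] (hℓ : 1 ≤ ℓ) (hℓr : ℓ < r)
    (hU : Measurable U)
    (h : ∀ x ∈ Set.Icc (0 : ℝ) ((r.choose ℓ : ℝ) ^ (-((r : ℝ) / (ℓ : ℝ)))),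
      μ.real {ω | U ω ≤ x} = productCDF ℓ r x) (a : ℕ) :
    ∫ ω, U ω ^ a ∂μ =
      (∫ z in continuousRegion ℓ r 1, (∏ k, z k) ^ a) / volume.real (continuousRegion ℓ r 1) := by
  have hpm : Measurable fun z : Fin r → ℝ => ∏ k, z k := by fun_prop
  rw [← integral_map (f := fun x : ℝ => x ^ a) hU.aemeasurable
    (continuous_pow a).aestronglyMeasurable, map_eq_of_productCDF hℓ hℓr hU h,
    integral_map hpm.aemeasurable (continuous_pow a).aestronglyMeasurable,
    ProbabilityTheory.cond, integral_smul_measure, ENNReal.toReal_inv, smul_eq_mul, div_eq_inv_mul]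
  rfl

lemma ae_mem_Icc_of_productCDF [IsProbabilityMeasure μ] (hℓ : 1 ≤ ℓ) (hℓr : ℓ < r)
    (hU : Measurable U)
    (h : ∀ x ∈ Set.Icc (0 : ℝ) ((r.choose ℓ : ℝ) ^ (-((r : ℝ) / (ℓ : ℝ)))),
      μ.real {ω | U ω ≤ x} = productCDF ℓ r x) : ∀ᵐ ω ∂μ, U ω ∈ Set.Icc (0 : ℝ) 1 := by
  have hpm : Measurable fun z : Fin r → ℝ => ∏ k, z k := by fun_prop
  refine (ae_map_iff hU.aemeasurable measurableSet_Icc).1 ?_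
  rw [map_eq_of_productCDF hℓ hℓr hU h]
  refine (ae_map_iff hpm.aemeasurable measurableSet_Icc).2 ?_
  refine (ae_cond_mem (measurableSet_continuousRegion ℓ r 1)).mono fun z hz => ?_
  refine ⟨Finset.prod_nonneg fun k _ => hz.1 k, (prod_le_rpow hℓ hℓr.le hz.1 hz.2).trans ?_⟩
  refine Real.rpow_le_one (by positivity) ?_ (by positivity)
  rw [one_div]
  exact inv_le_one_of_one_le₀ (by exact_mod_cast Nat.choose_pos hℓr.le)

end LimitLaw

/-- The moments of `U` are the limits of the moments of the scaled product of the coordinates. -/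
lemma isAdmissible_region_of_limit {r ℓ : ℕ} (hℓ : 1 ≤ ℓ) (hℓr : ℓ ≤ r)
    {Ω' : Type*} [MeasurableSpace Ω'] {μ : Measure Ω'} [IsProbabilityMeasure μ] {U : Ω' → ℝ}
    (hU : Measurable U)
    (hUlt : ℓ < r → ∀ x ∈ Set.Icc (0 : ℝ) ((r.choose ℓ : ℝ) ^ (-((r : ℝ) / (ℓ : ℝ)))),
      μ.real {ω | U ω ≤ x} = productCDF ℓ r x)
    (hUeq : ℓ = r → pdf.IsUniform U (Set.Icc (0 : ℝ) 1) μ volume) :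
    IsAdmissible (region hℓ hℓr) (fun n => scaledProduct (r := r) ℓ n) (fun a => ∫ ω, U ω ^ a ∂μ) ∧
      ∀ᵐ ω ∂μ, U ω ∈ Set.Icc (0 : ℝ) 1 := by
  rcases hℓr.lt_or_eq with h | rfl
  · refine ⟨?_, ae_mem_Icc_of_productCDF hℓ h hU (hUlt h)⟩
    simp only [integral_pow_of_productCDF hℓ h hU (hUlt h)]
    exact isAdmissible_region_lt hℓ h
  · refine ⟨?_, ae_mem_Icc_of_isUniform hU (hUeq rfl)⟩
    simp only [integral_pow_of_isUniform hU (hUeq rfl)]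
    exact isAdmissible_region_self hℓ

lemma integral_mul_comp_pow {Ω' β : Type*} [MeasurableSpace Ω'] [MeasurableSpace β]
    {μ : Measure Ω'} {U : Ω' → ℝ} {T : Ω' → β} {H : β → ℝ} (h : IndepFun U T μ)
    (hU : Measurable U) (hT : Measurable T) (hH : Measurable H) (a : ℕ) :
    ∫ ω, (U ω * H (T ω)) ^ a ∂μ = (∫ ω, U ω ^ a ∂μ) * ∫ ω, H (T ω) ^ a ∂μ := by
  simp only [mul_pow]
  exact h.integral_fun_comp_mul_comp (f := fun x : ℝ => x ^ a) (g := fun t => H t ^ a)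
    hU.aemeasurable hT.aemeasurable (continuous_pow a).aestronglyMeasurable
    (hH.pow_const a).aestronglyMeasurable

lemma integral_mul_primeProduct_pow {r : ℕ} {Ω' : Type*} [MeasurableSpace Ω'] {μ : Measure Ω'}
    {G : Fin r → Nat.Primes → Ω' → ℕ} (hG : ∀ k p, Measurable (G k p)) {U : Ω' → ℝ}
    (hU : Measurable U) (hUG : IndepFun U (fun ω (kp : Fin r × Nat.Primes) => G kp.1 kp.2 ω) μ)
    (a : ℕ) :
    ∫ ω, (U ω * primeProduct fun k p => G k p ω) ^ a ∂μ =
      (∫ ω, U ω ^ a ∂μ) * ∫ ω, (primeProduct fun k p => G k p ω) ^ a ∂μ := by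
  have hT : Measurable fun ω (kp : Fin r × Nat.Primes) => G kp.1 kp.2 ω :=
    measurable_pi_lambda _ fun kp => hG kp.1 kp.2
  -- The product is a measurable function of the whole family of exponents, so independence of `U`
  -- from the family suffices.
  have hH : Measurable fun g : Fin r × Nat.Primes → ℕ => primeProduct fun k p => g (k, p) :=
    measurable_primeProduct fun k p => measurable_pi_apply (k, p)
  exact integral_mul_comp_pow hUG hU hT hH a

lemma mul_mem_Icc_zero_one {x y : ℝ} (hx : x ∈ Set.Icc (0 : ℝ) 1) (hy : y ∈ Set.Icc (0 : ℝ) 1) :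
    x * y ∈ Set.Icc (0 : ℝ) 1 :=
  ⟨mul_nonneg hx.1 hy.1, mul_le_one₀ hx.2 hy.1 hy.2⟩

end HyperbolicLCM

theorem mainTheorem2
    (r ℓ : ℕ) (hr : 2 ≤ r) (hℓ : 1 ≤ ℓ) (hℓr : ℓ ≤ r)
    -- the random vectors `V n`, uniform on the discrete region for every `n ≥ binom r ℓ`
    {Ω : ℕ → Type*} [∀ n, MeasurableSpace (Ω n)]
    (P : (n : ℕ) → Measure (Ω n)) [∀ n, IsProbabilityMeasure (P n)]
    (V : (n : ℕ) → Ω n → Fin r → ℕ) (hV : ∀ n, Measurable (V n))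
    (hVunif : ∀ n, r.choose ℓ ≤ n → ∀ i ∈ HyperbolicLCM.discreteRegion ℓ r n,
      (P n).real {ω | V n ω = i} = 1 / ((HyperbolicLCM.discreteRegion ℓ r n).ncard : ℝ))
    -- the geometric variables `G k p` and the variable `U`
    {Ω' : Type*} [MeasurableSpace Ω'] (μ : Measure Ω') [IsProbabilityMeasure μ]
    (G : Fin r → Nat.Primes → Ω' → ℕ) (hG : ∀ k p, Measurable (G k p))
    (hGgeom : ∀ k p (j : ℕ), μ.real {ω | G k p ω = j} =
      (1 - 1 / ((p : ℕ) : ℝ)) * (1 / ((p : ℕ) : ℝ) ^ j))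
    (hGindep : iIndepFun (fun kp : Fin r × Nat.Primes => G kp.1 kp.2) μ)
    (U : Ω' → ℝ) (hU : Measurable U)
    (hUlt : ℓ < r → ∀ x ∈ Set.Icc (0 : ℝ) ((r.choose ℓ : ℝ) ^ (-((r : ℝ) / (ℓ : ℝ)))),
      μ.real {ω | U ω ≤ x} = HyperbolicLCM.productCDF ℓ r x)
    (hUeq : ℓ = r → pdf.IsUniform U (Set.Icc (0 : ℝ) 1) μ volume)
    (hUG : IndepFun U (fun ω (kp : Fin r × Nat.Primes) => G kp.1 kp.2 ω) μ) :
    -- convergence in distribution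
    TendstoInDistribution (fun n ω => HyperbolicLCM.lcmOverProduct (V n ω)) atTop
      (fun ω => HyperbolicLCM.primeProduct fun k p => G k p ω) P μ ∧
    TendstoInDistribution (fun n ω => HyperbolicLCM.lcmOverPower ℓ n (V n ω)) atTop
      (fun ω => U ω * HyperbolicLCM.primeProduct fun k p => G k p ω) P μ ∧
    -- convergence of all power moments of positive order, all of which are finite
    (∀ s : ℝ, 0 < s →
      (∀ n, r.choose ℓ ≤ n →
        Integrable (fun ω => HyperbolicLCM.lcmOverProduct (V n ω) ^ s) (P n)) ∧
      Integrable (fun ω => (HyperbolicLCM.primeProduct fun k p => G k p ω) ^ s) μ ∧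
      Tendsto (fun n => ∫ ω, HyperbolicLCM.lcmOverProduct (V n ω) ^ s ∂(P n)) atTop
        (𝓝 (∫ ω, (HyperbolicLCM.primeProduct fun k p => G k p ω) ^ s ∂μ))) ∧
    (∀ s : ℝ, 0 < s →
      (∀ n, r.choose ℓ ≤ n →
        Integrable (fun ω => HyperbolicLCM.lcmOverPower ℓ n (V n ω) ^ s) (P n)) ∧
      Integrable (fun ω => (U ω * HyperbolicLCM.primeProduct fun k p => G k p ω) ^ s) μ ∧
      Tendsto (fun n => ∫ ω, HyperbolicLCM.lcmOverPower ℓ n (V n ω) ^ s ∂(P n)) atTop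
        (𝓝 (∫ ω, (U ω * HyperbolicLCM.primeProduct fun k p => G k p ω) ^ s ∂μ))) := by
  have hcard := HyperbolicLCM.card_region_eq (r := r) hℓ hℓr
  have hne := fun n (hn : r.choose ℓ ≤ n) => HyperbolicLCM.region_nonempty hℓ hℓr hn
  have hunif : ∀ n, r.choose ℓ ≤ n → ∀ i ∈ HyperbolicLCM.region hℓ hℓr n,
      (P n).real {ω | V n ω = i} = 1 / ((HyperbolicLCM.region hℓ hℓr n).card : ℝ) := by
    intro n hn i hi
    rw [hcard]
    exact hVunif n hn i ((HyperbolicLCM.mem_region hℓ hℓr).1 hi)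
  have hmem : ∀ n, r.choose ℓ ≤ n → ∀ᵐ ω ∂(P n), V n ω ∈ HyperbolicLCM.region hℓ hℓr n :=
    fun n hn => HyperbolicLCM.ae_mem_of_uniform (hne n hn) (hV n) (hunif n hn)
  have hlarge : ∀ᶠ n in atTop, r.choose ℓ ≤ n := eventually_ge_atTop _
  obtain ⟨hadm, hU01⟩ := HyperbolicLCM.isAdmissible_region_of_limit hℓ hℓr hU hUlt hUeq
  have hmoments := fun a b =>
    hadm.tendsto_moments (μ := μ) hG hGgeom hGindep a b
  -- measurability and bounds
  have hA : ∀ n, Measurable fun ω => HyperbolicLCM.lcmOverProduct (V n ω) :=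
    fun n => (measurable_of_countable HyperbolicLCM.lcmOverProduct).comp (hV n)
  have hB : ∀ n, Measurable fun ω => HyperbolicLCM.lcmOverPower ℓ n (V n ω) :=
    fun n => (measurable_of_countable (HyperbolicLCM.lcmOverPower ℓ n)).comp (hV n)
  have hW := HyperbolicLCM.measurable_primeProduct hG
  have hUW := hU.mul hW
  have hA01 : ∀ n, ∀ᵐ ω ∂(P n), HyperbolicLCM.lcmOverProduct (V n ω) ∈ Set.Icc (0 : ℝ) 1 :=
    fun n => Eventually.of_forall fun ω =>
      ⟨HyperbolicLCM.lcmOverProduct_nonneg _, HyperbolicLCM.lcmOverProduct_le_one _⟩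
  have hW01 : ∀ᵐ ω ∂μ, (HyperbolicLCM.primeProduct fun k p => G k p ω) ∈ Set.Icc (0 : ℝ) 1 :=
    Eventually.of_forall fun ω =>
      ⟨HyperbolicLCM.primeProduct_nonneg _, HyperbolicLCM.primeProduct_le_one _⟩
  have hB01 : ∀ n, r.choose ℓ ≤ n → ∀ᵐ ω ∂(P n),
      HyperbolicLCM.lcmOverPower ℓ n (V n ω) ∈ Set.Icc (0 : ℝ) 1 := by
    intro n hn
    filter_upwards [hmem n hn, hA01 n] with ω hω hω'
    rw [HyperbolicLCM.lcmOverPower_eq ℓ n ((HyperbolicLCM.mem_region hℓ hℓr).1 hω).1]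
    exact HyperbolicLCM.mul_mem_Icc_zero_one ⟨HyperbolicLCM.scaledProduct_nonneg ℓ n _,
      HyperbolicLCM.scaledProduct_le_one hℓ hℓr hω⟩ hω'
  have hUW01 : ∀ᵐ ω ∂μ, U ω * (HyperbolicLCM.primeProduct fun k p => G k p ω) ∈
      Set.Icc (0 : ℝ) 1 := by
    filter_upwards [hU01, hW01] with ω h1 h2
    exact HyperbolicLCM.mul_mem_Icc_zero_one h1 h2
  -- convergence of the moments of integer order
  have hAmom : ∀ a : ℕ, Tendsto (fun n => ∫ ω, HyperbolicLCM.lcmOverProduct (V n ω) ^ a ∂(P n))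
      atTop (𝓝 (∫ ω, (HyperbolicLCM.primeProduct fun k p => G k p ω) ^ a ∂μ)) := by
    intro a
    -- With exponent 0 on the scaled product, its moment is 1 and only the ratio remains.
    have h := hmoments 0 a
    simp only [pow_zero, one_mul, integral_const, probReal_univ, smul_eq_mul] at h
    refine h.congr' ?_
    filter_upwards [hlarge] with n hn
    exact (HyperbolicLCM.integral_eq_avg_of_uniform (hne n hn) (hV n) (hunif n hn)
      fun i => HyperbolicLCM.lcmOverProduct i ^ a).symm
  have hBmom : ∀ a : ℕ, Tendsto (fun n => ∫ ω, HyperbolicLCM.lcmOverPower ℓ n (V n ω) ^ a ∂(P n))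
      atTop (𝓝 (∫ ω, (U ω * HyperbolicLCM.primeProduct fun k p => G k p ω) ^ a ∂μ)) := by
    intro a
    rw [HyperbolicLCM.integral_mul_primeProduct_pow hG hU hUG]
    refine (hmoments a a).congr' ?_
    filter_upwards [hlarge] with n hn
    rw [HyperbolicLCM.integral_eq_avg_of_uniform (hne n hn) (hV n) (hunif n hn)
      fun i => HyperbolicLCM.lcmOverPower ℓ n i ^ a]
    refine HyperbolicLCM.avg_congr fun i hi => ?_
    rw [HyperbolicLCM.lcmOverPower_eq ℓ n ((HyperbolicLCM.mem_region hℓ hℓr).1 hi).1, mul_pow]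
  refine ⟨HyperbolicLCM.tendstoInDistribution_of_tendsto_moments hA hW
      (Eventually.of_forall hA01) hW01 hAmom,
    HyperbolicLCM.tendstoInDistribution_of_tendsto_moments hB hUW (hlarge.mono hB01) hUW01 hBmom,
    fun s hs => ?_, fun s hs => ?_⟩
  -- For `s > 0` the power is continuous on the whole line, including at 0, so it is an admissible
  -- test function.
  · have hφ := Real.continuous_rpow_const hs.le
    exact ⟨fun n _ => HyperbolicLCM.integrable_comp_of_mem_Icc (hA n) (hA01 n) hφ,
      HyperbolicLCM.integrable_comp_of_mem_Icc hW hW01 hφ,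
      HyperbolicLCM.tendsto_integral_of_tendsto_moments hA hW (Eventually.of_forall hA01) hW01
        hAmom hφ⟩
  · have hφ := Real.continuous_rpow_const hs.le
    exact ⟨fun n hn => HyperbolicLCM.integrable_comp_of_mem_Icc (hB n) (hB01 n hn) hφ,
      HyperbolicLCM.integrable_comp_of_mem_Icc hUW hUW01 hφ,
      HyperbolicLCM.tendsto_integral_of_tendsto_moments hB hUW (hlarge.mono hB01) hUW01
        hBmom hφ⟩
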